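/- Let $p>2$ be a prime, let $I$ be a finite set of blocks, and for each $i\in I$ let $a_i\ge 0$ be an integer and $\mathcal O_i$ the ring of integers of a finite unramified extension of $\mathbb Q_p$. Let $K$ be a finite extension of $\mathbb Q_p$, with valuation $v$ normalized by $v(p)=1$, that contains the images of all the embeddings of the $\mathcal O_i$; let $\Sigma_i$ be the set of embeddings $\mathcal O_i\to K$. Put $G=\prod_i \mathrm{Res}_{\mathcal O_i/\mathbb Z_p}\mathrm{GL}_{a_i}$, with upper triangular Borel subgroup $B$, and let $\mathcal I\subset G(\mathbb Z_p)$ be the Iwahori subgroup of matrices that are upper triangular modulo $p$. Let $N\subset\mathcal I$ be the subgroup of lower triangular unipotent matrices congruent to the identity modulo $p$, so that $\mathcal I = N\cdot B(\mathbb Z_p)$, each element of $\mathcal I$ being uniquely of the form $nb$ with $n\in N$, $b\in B(\mathbb Z_p)$. Let $\chi=(k_{i,s,j})_{i\in I,\,s\in\Sigma_i,\,1\le j\le a_i}$ be a dominant algebraic weight: the $k_{i,s,j}$ are integers with $k_{i,s,1}\ge\dots\ge k_{i,s,a_i}$, and $\chi(b)=\prod_{i,s,j}s(b_{i,jj})^{k_{i,s,j}}$.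 Let $V_\chi$ be the space of regular functions $F$ on $G_K$ such that $F(gb)=\chi(b)F(g)$ for all $K$-algebras $R$ and all $g\in G(R)$, $b\in B(R)$; it is viewed as a space of functions $\mathcal I\to K$ by restriction. Let $\underline w=(w_i)_{i\in I}$ be a tuple of positive real numbers. A function on $N$ is $\underline w$-analytic if, for each $x\in N$, it is given on the points $y\in N$ of the closed polydisc $|s(y_{i,rc})-s(x_{i,rc})|\le p^{-w_i}$ (all $i$, $s\in\Sigma_i$, $r>c$) by a power series in the variables $s(y_{i,rc})-s(x_{i,rc})$ with coefficients in $K$ that converges on this polydisc. Let $V_\chi^{\underline w\text{-an}}$ be the space of functions $f:\mathcal I\to K$ with $f(gb)=\chi(b)f(g)$ for all $g\in\mathcal I$, $b\in B(\mathbb Z_p)$, whose restriction to $N$ is $\underline w$-analytic. For $i\in I$ and $1\le j<a_i$ let $d_{i,j}\in G(\mathbb Q_p)$ be the element with component $\mathrm{diag}(p^{-1}\mathrm{Id}_{a_i-j},\mathrm{Id}_j)$ in the block $i$ and the identity in the other blocks, and define the operator $\delta_{i,j}$ on $V_\chi^{\underline w\text{-an}}$ by $(\delta_{i,j}f)(nb)=f(d_{i,j}\,n\,d_{i,j}^{-1}\,b)$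 for $n\in N$, $b\in B(\mathbb Z_p)$. For each $i$ and each $1\le j\le a_i-1$ set $$\nu_{i,a_i-j}=\inf_{s\in\Sigma_i}\{k_{i,s,j}-k_{i,s,j+1}+1\},$$ and let $V_\chi^{\underline w\text{-an},<\underline\nu}$ be the intersection, over all $i$ and all $1\le j<a_i$, of the sum of the generalized eigenspaces of $\delta_{i,j}$ in $V_\chi^{\underline w\text{-an}}$ for the eigenvalues $\lambda\in K$ with $v(\lambda)<\nu_{i,j}$. Then $$V_\chi^{\underline w\text{-an},<\underline\nu}\subset V_\chi .$$ -/

import Mathlib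

open scoped TensorProduct MatrixGroups
open Matrix Filter Topology

universe u v w

namespace Iwahoric

/-! ### Subgroups of `GL_n(R)` -/

section Block

variable {n : ℕ} {R : Type*} [CommRing R]

/-- In a product of two upper triangular matrices the diagonal entries multiply. -/
theorem upper_mul_diag {M N : Matrix (Fin n) (Fin n) R} (hM : M.BlockTriangular id)
    (hN : N.BlockTriangular id) (j : Fin n) : (M * N) j j = M j j * N j j := by
  rw [Matrix.mul_apply]
  refine Finset.sum_eq_single j (fun l _ hl => ?_) (fun h => absurd (Finset.mem_univ _) h)
  rcases lt_or_gt_of_ne hl with h | h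
  · rw [hM (show id l < id j from h), zero_mul]
  · rw [hN (show id j < id l from h), mul_zero]

/-- In a product of two lower triangular matrices the diagonal entries multiply. -/
theorem lower_mul_diag {M N : Matrix (Fin n) (Fin n) R}
    (hM : M.BlockTriangular OrderDual.toDual) (hN : N.BlockTriangular OrderDual.toDual)
    (j : Fin n) : (M * N) j j = M j j * N j j := by
  rw [Matrix.mul_apply]
  refine Finset.sum_eq_single j (fun l _ hl => ?_) (fun h => absurd (Finset.mem_univ _) h)
  rcases lt_or_gt_of_ne hl with h | h
  · rw [hN (show OrderDual.toDual j < OrderDual.toDual l from h), mul_zero]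
  · rw [hM (show OrderDual.toDual l < OrderDual.toDual j from h), zero_mul]

theorem inv_triangular {α : Type*} [LinearOrder α] {f : Fin n → α} (g : GL (Fin n) R)
    (h : (g : Matrix (Fin n) (Fin n) R).BlockTriangular f) :
    ((g⁻¹ : GL (Fin n) R) : Matrix (Fin n) (Fin n) R).BlockTriangular f := by
  rw [Matrix.coe_units_inv]
  let _ : Invertible (g : Matrix (Fin n) (Fin n) R) := Units.invertible g
  exact Matrix.blockTriangular_inv_of_blockTriangular h

variable (n R) in
/-- The Borel subgroup `B_n(R)` of upper triangular matrices. -/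
def borel : Subgroup (GL (Fin n) R) where
  carrier := {g | (g : Matrix (Fin n) (Fin n) R).BlockTriangular id}
  mul_mem' {g h} hg hh := by
    simp only [Set.mem_ofPred_eq, Units.val_mul] at *
    exact hg.mul hh
  one_mem' := by
    simp only [Set.mem_ofPred_eq, Units.val_one]
    exact Matrix.blockTriangular_one
  inv_mem' {g} hg := inv_triangular g hg

variable (n R) in
/-- The unipotent radical `U_n^op(R)` of the opposite Borel subgroup: lower triangular matrices
with ones on the diagonal. -/
def unipOp : Subgroup (GL (Fin n) R) where
  carrier := {g | (g : Matrix (Fin n) (Fin n) R).BlockTriangular OrderDual.toDual ∧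
    ∀ j, (g : Matrix (Fin n) (Fin n) R) j j = 1}
  mul_mem' {g h} hg hh := by
    simp only [Set.mem_ofPred_eq, Units.val_mul] at *
    refine ⟨hg.1.mul hh.1, fun j => ?_⟩
    rw [lower_mul_diag hg.1 hh.1, hg.2, hh.2, one_mul]
  one_mem' := by
    simp only [Set.mem_ofPred_eq, Units.val_one]
    exact ⟨Matrix.blockTriangular_one, fun j => Matrix.one_apply_eq j⟩
  inv_mem' {g} hg := by
    refine ⟨inv_triangular g hg.1, fun j => ?_⟩
    have h := lower_mul_diag hg.1 (inv_triangular g hg.1) j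
    rw [← Units.val_mul, mul_inv_cancel, Units.val_one, Matrix.one_apply_eq, hg.2, one_mul] at h
    exact h.symm

/-- The `j`-th diagonal entry of an invertible upper triangular matrix, as a unit. -/
def diagUnit (b : borel n R) (j : Fin n) : Rˣ where
  val := (b : GL (Fin n) R) j j
  inv := ((b⁻¹ : borel n R) : GL (Fin n) R) j j
  val_inv := by
    have h := upper_mul_diag b.2 (b⁻¹).2 j
    rw [← Units.val_mul, ← Subgroup.coe_mul, mul_inv_cancel] at h
    simpa using h.symm
  inv_val := by
    have h := upper_mul_diag (b⁻¹).2 b.2 j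
    rw [← Units.val_mul, ← Subgroup.coe_mul, inv_mul_cancel] at h
    simpa using h.symm

variable (p : ℕ)

variable (n R) in
/-- Reduction modulo `p`. -/
def reduction : GL (Fin n) R →* GL (Fin n) (R ⧸ Ideal.span {(p : R)}) :=
  Matrix.GeneralLinearGroup.map (Ideal.Quotient.mk (Ideal.span {(p : R)}))

variable (n R) in
/-- The Iwahori subgroup: matrices that are upper triangular modulo `p`. -/
def iwahori : Subgroup (GL (Fin n) R) :=
  (borel n (R ⧸ Ideal.span {(p : R)})).comap (reduction n R p)

variable (n R) in
/-- The subgroup of `U_n^op(R)` of matrices that reduce to the identity modulo `p`. -/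
def nop : Subgroup (GL (Fin n) R) :=
  unipOp n R ⊓ (reduction n R p).ker

theorem mem_iwahori_iff {g : GL (Fin n) R} :
    g ∈ iwahori n R p ↔ ∀ r c : Fin n, c < r → (p : R) ∣ g r c := by
  have : g ∈ iwahori n R p ↔ ∀ r c : Fin n, c < r →
      Ideal.Quotient.mk (Ideal.span {(p : R)}) (g r c) = 0 := Iff.rfl
  rw [this]
  simp only [Ideal.Quotient.eq_zero_iff_mem, Ideal.mem_span_singleton]

theorem mem_nop_iff {g : GL (Fin n) R} :
    g ∈ nop n R p ↔ (∀ r c : Fin n, r < c → g r c = 0) ∧ (∀ r, g r r = 1) ∧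
      ∀ r c : Fin n, c < r → (p : R) ∣ g r c := by
  have h1 : g ∈ nop n R p ↔ ((∀ r c : Fin n, r < c → g r c = 0) ∧ ∀ r, g r r = 1) ∧
      reduction n R p g = 1 := Iff.rfl
  have h2 : reduction n R p g = 1 ↔ ∀ r c : Fin n,
      Ideal.Quotient.mk (Ideal.span {(p : R)}) (g r c) =
        (1 : Matrix (Fin n) (Fin n) (R ⧸ Ideal.span {(p : R)})) r c := by
    rw [Units.ext_iff]
    exact ⟨fun h r c => congrFun (congrFun h r) c, fun h => by ext r c; exact h r c⟩
  rw [h1, h2]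
  constructor
  · rintro ⟨⟨h3, h4⟩, h5⟩
    refine ⟨h3, h4, fun r c hrc => ?_⟩
    have := h5 r c
    rwa [Matrix.one_apply_ne hrc.ne', Ideal.Quotient.eq_zero_iff_mem,
      Ideal.mem_span_singleton] at this
  · rintro ⟨h3, h4, h5⟩
    refine ⟨⟨h3, h4⟩, fun r c => ?_⟩
    rcases lt_trichotomy r c with h | h | h
    · rw [h3 r c h, Matrix.one_apply_ne h.ne, map_zero]
    · subst h
      rw [h4, Matrix.one_apply_eq, map_one]
    · rw [Matrix.one_apply_ne h.ne', Ideal.Quotient.eq_zero_iff_mem, Ideal.mem_span_singleton]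
      exact h5 r c h

theorem borel_le_iwahori : borel n R ≤ iwahori n R p := fun g hg => by
  rw [mem_iwahori_iff]
  intro r c h
  rw [show g r c = 0 from hg h]
  exact dvd_zero _

theorem nop_le_iwahori : nop n R p ≤ iwahori n R p := fun g hg => by
  rw [mem_nop_iff] at hg
  exact (mem_iwahori_iff p).2 hg.2.2

theorem isUnit_diag_of_mem_iwahori [IsLocalRing R] (hp : ¬ IsUnit (p : R)) {g : GL (Fin n) R}
    (hg : g ∈ iwahori n R p) (j : Fin n) : IsUnit (g j j) := by
  have h := (diagUnit ⟨reduction n R p g, hg⟩ j).isUnit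
  have h' : IsUnit (Ideal.Quotient.mk (Ideal.span {(p : R)}) (g j j)) := h
  have hle : Ideal.span {(p : R)} ≤ IsLocalRing.maximalIdeal R := by
    rw [Ideal.span_singleton_le_iff_mem]
    exact (IsLocalRing.mem_maximalIdeal _).2 hp
  by_contra hn
  have hm : g j j ∈ IsLocalRing.maximalIdeal R := (IsLocalRing.mem_maximalIdeal _).2 hn
  obtain ⟨y, hy⟩ := h'.exists_right_inv
  obtain ⟨z, rfl⟩ := Ideal.Quotient.mk_surjective y
  rw [← map_mul, ← map_one (Ideal.Quotient.mk _), Ideal.Quotient.eq] at hy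
  have h1 : (1 : R) ∈ IsLocalRing.maximalIdeal R := by
    have := Ideal.sub_mem _ (Ideal.mul_mem_right z _ hm) (hle hy)
    rwa [sub_sub_cancel] at this
  exact (Ideal.ne_top_iff_one _).1 (IsLocalRing.maximalIdeal.isMaximal R).ne_top h1

/-- A matrix with the shape of an element of `nop`, as an element of `GL_n(R)`. -/
noncomputable def lowerMk (M : Matrix (Fin n) (Fin n) R)
    (h0 : ∀ r c, r < c → M r c = 0) (h1 : ∀ r, M r r = 1) : GL (Fin n) R :=
  Matrix.GeneralLinearGroup.mk'' M (by
    rw [Matrix.det_of_isLowerTriangular M (fun r c h => h0 r c h)]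
    simp [h1])

@[simp] theorem lowerMk_apply (M : Matrix (Fin n) (Fin n) R)
    (h0 : ∀ r c, r < c → M r c = 0) (h1 : ∀ r, M r r = 1) (r c : Fin n) :
    lowerMk M h0 h1 r c = M r c := rfl

/-- Iwahori decomposition, existence. -/
theorem exists_iwahori_decomposition [IsLocalRing R] (hp : ¬ IsUnit (p : R))
    (g : iwahori n R p) : ∃ (l : nop n R p) (b : borel n R),
      (g : GL (Fin n) R) = (l : GL (Fin n) R) * (b : GL (Fin n) R) := by
  have key : ∀ k : ℕ, k ≤ n → ∃ l : nop n R p, ∀ r c : Fin n, c < r → (c : ℕ) < k →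
      ((l : GL (Fin n) R) * (g : GL (Fin n) R) : GL (Fin n) R) r c = 0 := by
    intro k
    induction k with
    | zero => exact fun _ => ⟨1, fun r c _ h => absurd h (Nat.not_lt_zero _)⟩
    | succ k ih =>
      intro hk
      obtain ⟨l, hl⟩ := ih (by omega)
      set m : GL (Fin n) R := (l : GL (Fin n) R) * (g : GL (Fin n) R) with hm
      have hmI : m ∈ iwahori n R p := mul_mem (nop_le_iwahori p l.2) g.2
      let k' : Fin n := ⟨k, by omega⟩
      obtain ⟨y, hy⟩ := (isUnit_diag_of_mem_iwahori p hp hmI k').exists_left_inv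
      let E : Matrix (Fin n) (Fin n) R := Matrix.of fun r c =>
        if r = c then 1 else if c = k' ∧ k' < r then -(m r k' * y) else 0
      have hE0 : ∀ r c, r < c → E r c = 0 := by
        intro r c h
        simp only [E, Matrix.of_apply, if_neg h.ne]
        rw [if_neg]
        rintro ⟨rfl, h'⟩
        exact absurd h' h.not_gt
      have hE1 : ∀ r, E r r = 1 := fun r => by simp [E]
      have hE : lowerMk E hE0 hE1 ∈ nop n R p := by
        rw [mem_nop_iff]
        refine ⟨fun r c h => by simpa using hE0 r c h, fun r => by simpa using hE1 r,
          fun r c h => ?_⟩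
        simp only [lowerMk_apply, E, Matrix.of_apply, if_neg h.ne']
        split_ifs with h'
        · exact (Dvd.dvd.mul_right ((mem_iwahori_iff p).1 hmI r k' h'.2) y).neg_right
        · exact dvd_zero _
      refine ⟨⟨_, hE⟩ * l, fun r c hcr hck => ?_⟩
      have hmul : (((⟨_, hE⟩ * l : nop n R p) : GL (Fin n) R) * (g : GL (Fin n) R)) =
          lowerMk E hE0 hE1 * m := by
        rw [hm, Subgroup.coe_mul, mul_assoc]
      rw [hmul, Units.val_mul, Matrix.mul_apply]
      change ∑ s, E r s * m s c = 0
      by_cases hr : k' < r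
      · have hne : r ≠ k' := hr.ne'
        have : ∀ s, E r s * m s c =
            (if s = r then m r c else 0) + (if s = k' then -(m r k' * y) * m k' c else 0) := by
          intro s
          by_cases h1 : s = r
          · subst h1
            simp [E, hne]
          · by_cases h2 : s = k'
            · subst h2
              simp [E, h1, Ne.symm h1, hr]
            · simp [E, h1, h2, Ne.symm h1]
        rw [Finset.sum_congr rfl (fun s _ => this s), Finset.sum_add_distrib,
          Finset.sum_ite_eq' Finset.univ r, Finset.sum_ite_eq' Finset.univ k']
        simp only [Finset.mem_univ, if_true]
        rcases Nat.lt_succ_iff_lt_or_eq.1 hck with h | h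
        · rw [hl r c hcr h, hl k' c (show (c : ℕ) < k from h) h]
          simp
        · have hc : c = k' := Fin.ext h
          subst hc
          linear_combination (-(m r k')) * hy
      · have hck' : (c : ℕ) < k := by
          have h1 : (r : ℕ) ≤ k := not_lt.1 hr
          have h2 : (c : ℕ) < r := hcr
          omega
        rw [Finset.sum_eq_single r]
        · rw [hE1, one_mul, hl r c hcr hck']
        · intro s _ hs
          have : E r s = 0 := by
            simp only [E, Matrix.of_apply, if_neg (Ne.symm hs)]
            rw [if_neg (fun h => hr h.2)]
          rw [this, zero_mul]
        · exact fun h => absurd (Finset.mem_univ _) h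
  obtain ⟨l, hl⟩ := key n le_rfl
  refine ⟨l⁻¹, ⟨(l : GL (Fin n) R) * (g : GL (Fin n) R), fun r c h => hl r c h c.2⟩, ?_⟩
  simp

/-- Iwahori decomposition, uniqueness. -/
theorem iwahori_decomposition_unique {l l' : nop n R p} {b b' : borel n R}
    (h : (l : GL (Fin n) R) * (b : GL (Fin n) R) = (l' : GL (Fin n) R) * (b' : GL (Fin n) R)) :
    l = l' ∧ b = b' := by
  have h1 : ((l'⁻¹ * l : nop n R p) : GL (Fin n) R) = ((b' * b⁻¹ : borel n R) : GL (Fin n) R) := by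
    simp only [Subgroup.coe_mul, Subgroup.coe_inv]
    rw [inv_mul_eq_iff_eq_mul, ← mul_assoc, ← h, mul_inv_cancel_right]
  have h2 := (mem_nop_iff p).1 (l'⁻¹ * l).2
  have h3 := (b' * b⁻¹).2
  have h4 : ((l'⁻¹ * l : nop n R p) : GL (Fin n) R) = 1 := by
    apply Units.ext
    ext r c
    rcases lt_trichotomy r c with hrc | hrc | hrc
    · rw [h2.1 r c hrc, Units.val_one, Matrix.one_apply_ne hrc.ne]
    · subst hrc
      rw [h2.2.1, Units.val_one, Matrix.one_apply_eq]
    · rw [h1, Units.val_one, Matrix.one_apply_ne hrc.ne']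
      exact h3 hrc
  have h5 : l = l' := by
    have : l'⁻¹ * l = 1 := Subtype.ext h4
    exact (inv_mul_eq_one.1 this).symm
  have h6 : b = b' := by
    rw [h4] at h1
    have : b' * b⁻¹ = 1 := Subtype.ext h1.symm
    exact (mul_inv_eq_one.1 this).symm
  exact ⟨h5, h6⟩

/-- The matrix of `d l d⁻¹`, for `l` in `nop` and `d = diag(p⁻¹ Id_{n-j}, Id_j)`: the entries in
the lower left block (rows `> n - j`, columns `≤ n - j`, counted from one) are multiplied by `p`,
and the others do not change (see `map_conjD`). -/
noncomputable def conjD (j : ℕ) (l : nop n R p) : nop n R p :=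
  ⟨lowerMk (Matrix.of fun r c => if (c : ℕ) < n - j ∧ n - j ≤ (r : ℕ) then
      (p : R) * (l : GL (Fin n) R) r c else (l : GL (Fin n) R) r c)
    (fun r c h => by
      simp [((mem_nop_iff p).1 l.2).1 r c h])
    (fun r => by
      have : ¬ ((r : ℕ) < n - j ∧ n - j ≤ (r : ℕ)) := by omega
      rw [Matrix.of_apply, if_neg this, ((mem_nop_iff p).1 l.2).2.1 r]),
    by
      have hl := (mem_nop_iff p).1 l.2
      rw [mem_nop_iff]
      refine ⟨fun r c h => ?_, fun r => ?_, fun r c h => ?_⟩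
      · simp [hl.1 r c h]
      · have : ¬ ((r : ℕ) < n - j ∧ n - j ≤ (r : ℕ)) := by omega
        rw [lowerMk_apply, Matrix.of_apply, if_neg this, hl.2.1 r]
      · simp only [lowerMk_apply, Matrix.of_apply]
        split_ifs
        · exact dvd_mul_right _ _
        · exact hl.2.2 r c h⟩

theorem conjD_apply (j : ℕ) (l : nop n R p) (r c : Fin n) :
    (conjD p j l : GL (Fin n) R) r c = if (c : ℕ) < n - j ∧ n - j ≤ (r : ℕ) then
      (p : R) * (l : GL (Fin n) R) r c else (l : GL (Fin n) R) r c := rfl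

/-- The matrix `diag(p⁻¹ Id_{n-j}, Id_j)` over a field in which `p` is not zero. -/
noncomputable def dMat {L : Type*} [Field L] (hp : (p : L) ≠ 0) (j : ℕ) : GL (Fin n) L where
  val := Matrix.diagonal fun r => if (r : ℕ) < n - j then (p : L)⁻¹ else 1
  inv := Matrix.diagonal fun r => if (r : ℕ) < n - j then (p : L) else 1
  val_inv := by
    rw [Matrix.diagonal_mul_diagonal, ← Matrix.diagonal_one]
    congr 1
    ext r
    split_ifs <;> simp [hp]
  inv_val := by
    rw [Matrix.diagonal_mul_diagonal, ← Matrix.diagonal_one]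
    congr 1
    ext r
    split_ifs <;> simp [hp]

/-- `conjD` is conjugation by `diag(p⁻¹ Id_{n-j}, Id_j)`. -/
theorem map_conjD {L : Type*} [Field L] (φ : R →+* L) (hp : (p : L) ≠ 0) (j : ℕ)
    (l : nop n R p) :
    Matrix.GeneralLinearGroup.map φ (conjD p j l : GL (Fin n) R) =
      dMat p hp j * Matrix.GeneralLinearGroup.map φ (l : GL (Fin n) R) * (dMat p hp j)⁻¹ := by
  apply Units.ext
  ext r c
  have hl := (mem_nop_iff p).1 l.2
  have h1 : (((dMat p hp j)⁻¹ : GL (Fin n) L) : Matrix (Fin n) (Fin n) L) =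
    Matrix.diagonal fun r : Fin n => if (r : ℕ) < n - j then (p : L) else 1 := rfl
  have h2 : ((dMat p hp j : GL (Fin n) L) : Matrix (Fin n) (Fin n) L) =
    Matrix.diagonal fun r : Fin n => if (r : ℕ) < n - j then (p : L)⁻¹ else 1 := rfl
  rw [Units.val_mul, Units.val_mul, h1, h2, Matrix.mul_diagonal, Matrix.diagonal_mul]
  change φ ((conjD p j l : GL (Fin n) R) r c) = _ * φ ((l : GL (Fin n) R) r c) * _
  rw [conjD_apply]
  by_cases hc : (c : ℕ) < n - j <;> by_cases hr : (r : ℕ) < n - j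
  · simp only [hc, hr, true_and, if_true, not_le.2 hr, if_false]
    field_simp
  · simp only [hc, hr, true_and, if_true, not_lt.1 hr, if_false, map_mul, map_natCast]
    ring
  · have : r < c := Fin.lt_def.2 (by omega)
    simp [hl.1 r c this]
  · simp [hc, hr]

end Block

/-! ### Products of blocks -/

section Product

variable (p : ℕ) [Fact p.Prime] {ι : Type w} (a : ι → ℕ)
  (O : ι → Type v) [∀ i, CommRing (O i)] [∀ i, Algebra ℤ_[p] (O i)]
  (K : Type u) [NormedField K] [NormedAlgebra ℚ_[p] K] [Algebra ℤ_[p] K]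

/-- The Iwahori subgroup of `∏ i, GL_{a i}(O i)`. -/
abbrev Iw := ∀ i, iwahori (a i) (O i) p

/-- The group of lower triangular unipotent elements of `∏ i, GL_{a i}(O i)` that reduce to the
identity modulo `p`. -/
abbrev Nop := ∀ i, nop (a i) (O i) p

/-- The group of upper triangular elements of `∏ i, GL_{a i}(O i)`. -/
abbrev Bor := ∀ i, borel (a i) (O i)

variable {a O} in
/-- The inclusion of `Nop` in the Iwahori subgroup. -/
def Nop.toIw (l : Nop p a O) : Iw p a O := fun i => ⟨l i, nop_le_iwahori p (l i).2⟩

variable {a O} in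
/-- The inclusion of `Bor` in the Iwahori subgroup. -/
def Bor.toIw (b : Bor a O) : Iw p a O := fun i => ⟨b i, borel_le_iwahori p (b i).2⟩

/-- The weights: tuples of integers `k i τ j`, where `τ` runs over the embeddings of `O i` in `K`
and `j` over the diagonal positions of the block `i`. -/
abbrev Weight := ∀ i, (O i →ₐ[ℤ_[p]] K) → Fin (a i) → ℤ

variable {p a O K} in
/-- Dominance with respect to the upper triangular Borel subgroup. -/
def Weight.IsDominant (k : Weight p a O K) : Prop := ∀ i τ, Antitone (k i τ)

variable {p a O K} in
/-- The value of the character of weight `k` on an upper triangular element with entries in the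
`O i`. -/
noncomputable def Weight.char [Fintype ι] [∀ i, Fintype (O i →ₐ[ℤ_[p]] K)]
    (k : Weight p a O K) (b : Bor a O) : Kˣ :=
  ∏ i, ∏ τ : O i →ₐ[ℤ_[p]] K, ∏ j,
    Units.map (τ : O i →* K) (diagUnit (b i) j) ^ k i τ j

/-- The index set of the coordinates on the opposite unipotent group over `K`: a block `i`, an
embedding `τ` of `O i` in `K` and a position `(r, c)` strictly below the diagonal. -/
abbrev Coord := Σ i, (O i →ₐ[ℤ_[p]] K) × {x : Fin (a i) × Fin (a i) // x.2 < x.1}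

variable {p a O K} in
/-- The coordinates of an element of `Nop`. -/
noncomputable def Nop.coord (l : Nop p a O) (e : Coord p a O K) : K :=
  e.2.1 ((l e.1 : GL (Fin (a e.1)) (O e.1)) e.2.2.1.1 e.2.2.1.2)

variable {p a O K} in
/-- `w`-analytic functions on `Nop`: for each centre `x`, the function is given, at the points
of `Nop` in the closed polydisc of centre `x` and radius `p ^ (-w i)` in the coordinates of the
block `i`, by a power series with coefficients in `K` that converges on this polydisc. -/
def IsAnalytic (w : ι → ℝ) (f : Nop p a O → K) : Prop :=
  ∀ x : Nop p a O, ∃ c : (Coord p a O K →₀ ℕ) → K,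
    Tendsto (fun α : Coord p a O K →₀ ℕ =>
      ‖c α‖ * α.prod fun e m => ((p : ℝ) ^ (-(w e.1))) ^ m) cofinite (𝓝 0) ∧
    ∀ y : Nop p a O,
      (∀ e : Coord p a O K, ‖y.coord e - x.coord e‖ ≤ (p : ℝ) ^ (-(w e.1))) →
      HasSum (fun α : Coord p a O K →₀ ℕ =>
        c α * α.prod fun e m => (y.coord e - x.coord e) ^ m) (f y)

variable {p a O K} in
/-- The space of `w`-analytic functions on the Iwahori subgroup induced from the character of
weight `k`. -/
def analyticInduction [Fintype ι] [∀ i, Fintype (O i →ₐ[ℤ_[p]] K)]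
    (k : Weight p a O K) (w : ι → ℝ) : Submodule K (Iw p a O → K) where
  carrier := {f | (∀ (g : Iw p a O) (b : Bor a O), f (g * b.toIw p) = (k.char b : K) * f g) ∧
    IsAnalytic w fun l : Nop p a O => f (l.toIw p)}
  add_mem' := by
    rintro f f' ⟨hf, hf2⟩ ⟨hf', hf2'⟩
    refine ⟨fun g b => ?_, fun x => ?_⟩
    · rw [Pi.add_apply, Pi.add_apply, hf, hf', mul_add]
    · obtain ⟨c, hc, hs⟩ := hf2 x
      obtain ⟨c', hc', hs'⟩ := hf2' x
      refine ⟨c + c', ?_, fun y hy => ?_⟩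
      · have h0 := hc.add hc'
        rw [add_zero] at h0
        refine squeeze_zero (fun α => ?_) (fun α => ?_) h0
        · exact mul_nonneg (norm_nonneg _) (Finset.prod_nonneg fun e _ => by positivity)
        · rw [← add_mul]
          exact mul_le_mul_of_nonneg_right (norm_add_le _ _)
            (Finset.prod_nonneg fun e _ => by positivity)
      · have := (hs y hy).add (hs' y hy)
        simpa only [Pi.add_apply, add_mul] using this
  zero_mem' := by
    refine ⟨fun g b => by simp, fun x => ⟨0, ?_, fun y _ => ?_⟩⟩
    · simpa using tendsto_const_nhds
    · simp
  smul_mem' := by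
    rintro t f ⟨hf, hf2⟩
    refine ⟨fun g b => ?_, fun x => ?_⟩
    · rw [Pi.smul_apply, Pi.smul_apply, hf, smul_eq_mul, smul_eq_mul, mul_left_comm]
    · obtain ⟨c, hc, hs⟩ := hf2 x
      refine ⟨t • c, ?_, fun y hy => ?_⟩
      · have h0 := hc.const_mul ‖t‖
        rw [mul_zero] at h0
        simpa only [Pi.smul_apply, smul_eq_mul, norm_mul, mul_assoc] using h0
      · have := (hs y hy).mul_left t
        simpa only [Pi.smul_apply, smul_eq_mul, mul_assoc] using this

section Delta

variable {p a O}
variable [∀ i, IsLocalRing (O i)] (hp : ∀ i, Irreducible (p : O i))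

/-- The component in `Nop` of the Iwahori decomposition `g = l b`. -/
noncomputable def nPart (g : Iw p a O) : Nop p a O := fun i =>
  (exists_iwahori_decomposition p (hp i).not_isUnit (g i)).choose

/-- The component in `Bor` of the Iwahori decomposition `g = l b`. -/
noncomputable def bPart (g : Iw p a O) : Bor a O := fun i =>
  (exists_iwahori_decomposition p (hp i).not_isUnit (g i)).choose_spec.choose

theorem nPart_mul_bPart (g : Iw p a O) :
    (nPart hp g).toIw p * (bPart hp g).toIw p = g := by
  funext i
  exact Subtype.ext (exists_iwahori_decomposition p (hp i).not_isUnit (g i)).choose_spec.choose_spec.symm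

theorem parts_eq (l : Nop p a O) (b : Bor a O) :
    nPart hp (l.toIw p * b.toIw p) = l ∧ bPart hp (l.toIw p * b.toIw p) = b := by
  have h : ∀ i, nPart hp (l.toIw p * b.toIw p) i = l i ∧
      bPart hp (l.toIw p * b.toIw p) i = b i := fun i =>
    iwahori_decomposition_unique p
      (congrArg Subtype.val (congrFun (nPart_mul_bPart hp (l.toIw p * b.toIw p)) i))
  exact ⟨funext fun i => (h i).1, funext fun i => (h i).2⟩

variable [DecidableEq ι]

/-- `l ↦ d l d⁻¹`, where the component of `d` in the block `i` is
`diag(p⁻¹ Id_{a i - j}, Id_j)` and the other components are the identity. -/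
noncomputable def conjBlock (i : ι) (j : ℕ) (l : Nop p a O) : Nop p a O :=
  Function.update l i (conjD p j (l i))

variable {K}

open Classical in
theorem coord_conjBlock (i : ι) (j : ℕ) (l : Nop p a O) (e : Coord p a O K) :
    (conjBlock i j l).coord e =
      (if e.1 = i ∧ (e.2.2.1.2 : ℕ) < a e.1 - j ∧ a e.1 - j ≤ (e.2.2.1.1 : ℕ)
        then (p : K) else 1) * l.coord e := by
  obtain ⟨i', τ, ⟨⟨r, c⟩, hrc⟩⟩ := e
  by_cases h : i' = i
  · subst h
    simp only [Nop.coord, conjBlock, Function.update_self, conjD_apply, true_and]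
    split_ifs
    · rw [map_mul, map_natCast]
    · rw [one_mul]
  · simp only [Nop.coord, conjBlock, Function.update_of_ne h, h, false_and, if_false, one_mul]

/-- The formula `(δ_{i,j} f)(g) = f (d l d⁻¹ b)`, where `g = l b` is the Iwahori
decomposition. -/
noncomputable def deltaFun (i : ι) (j : ℕ) (f : Iw p a O → K) : Iw p a O → K := fun g =>
  f ((conjBlock i j (nPart hp g)).toIw p * (bPart hp g).toIw p)

theorem deltaFun_apply (i : ι) (j : ℕ) (f : Iw p a O → K) (l : Nop p a O) (b : Bor a O) :
    deltaFun hp i j f (l.toIw p * b.toIw p) =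
      f ((conjBlock i j l).toIw p * b.toIw p) := by
  rw [deltaFun, (parts_eq hp l b).1, (parts_eq hp l b).2]

theorem deltaFun_apply_nop (i : ι) (j : ℕ) (f : Iw p a O → K) (l : Nop p a O) :
    deltaFun hp i j f (l.toIw p) = f ((conjBlock i j l).toIw p) := by
  have h1 : ∀ l : Nop p a O, l.toIw p = l.toIw p * (1 : Bor a O).toIw p :=
    fun l => (mul_one (l.toIw p)).symm
  rw [h1 l, deltaFun_apply, ← h1]

theorem IsAnalytic.comp_conjBlock {w : ι → ℝ} {f : Nop p a O → K} (hf : IsAnalytic w f)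
    (i : ι) (j : ℕ) : IsAnalytic w fun l => f (conjBlock i j l) := by
  classical
  intro x
  obtain ⟨c, hc, hs⟩ := hf (conjBlock i j x)
  let s : Coord p a O K → K := fun e =>
    if e.1 = i ∧ (e.2.2.1.2 : ℕ) < a e.1 - j ∧ a e.1 - j ≤ (e.2.2.1.1 : ℕ)
      then (p : K) else 1
  have hpK : ‖(p : K)‖ ≤ 1 := by
    rw [← map_natCast (algebraMap ℚ_[p] K) p, norm_algebraMap']
    exact Padic.norm_p_lt_one.le
  have hs1 : ∀ e, ‖s e‖ ≤ 1 := by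
    intro e
    simp only [s]
    split_ifs
    · exact hpK
    · exact norm_one.le
  have hsub : ∀ (y : Nop p a O) (e : Coord p a O K),
      (conjBlock i j y).coord e - (conjBlock i j x).coord e =
        s e * (y.coord e - x.coord e) := by
    intro y e
    rw [coord_conjBlock, coord_conjBlock, mul_sub]
  refine ⟨fun α => c α * α.prod fun e m => s e ^ m, ?_, fun y hy => ?_⟩
  · refine squeeze_zero (fun α => ?_) (fun α => ?_) hc
    · exact mul_nonneg (norm_nonneg _) (Finset.prod_nonneg fun e _ => by positivity)
    · refine mul_le_mul_of_nonneg_right ?_ (Finset.prod_nonneg fun e _ => by positivity)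
      rw [norm_mul]
      refine mul_le_of_le_one_right (norm_nonneg _) ?_
      rw [Finsupp.prod, norm_prod]
      refine Finset.prod_le_one (fun e _ => norm_nonneg _) (fun e _ => ?_)
      rw [norm_pow]
      exact pow_le_one₀ (norm_nonneg _) (hs1 e)
  · have h3 := hs (conjBlock i j y) (fun e => by
      rw [hsub, norm_mul]
      exact (mul_le_of_le_one_left (norm_nonneg _) (hs1 e)).trans (hy e))
    convert h3 using 2 with α
    rw [mul_assoc, ← Finsupp.prod_mul]
    simp only [hsub, mul_pow]

variable [Fintype ι] [∀ i, Fintype (O i →ₐ[ℤ_[p]] K)]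

theorem deltaFun_mem {k : Weight p a O K} {w : ι → ℝ} (i : ι) (j : ℕ) {f : Iw p a O → K}
    (hf : f ∈ analyticInduction k w) : deltaFun hp i j f ∈ analyticInduction k w := by
  refine ⟨fun g b => ?_, ?_⟩
  · have hb : ∀ b b' : Bor a O, b.toIw p * b'.toIw p = (b * b').toIw p := fun b b' => rfl
    obtain ⟨l, b', rfl⟩ : ∃ (l : Nop p a O) (b' : Bor a O), l.toIw p * b'.toIw p = g :=
      ⟨_, _, nPart_mul_bPart hp g⟩
    rw [mul_assoc, hb, deltaFun_apply, deltaFun_apply, ← hb, ← mul_assoc]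
    exact hf.1 _ b
  · simp only [deltaFun_apply_nop]
    exact hf.2.comp_conjBlock i j

/-- The operator `δ_{i,j}` on the space of `w`-analytic induced functions. -/
noncomputable def delta (k : Weight p a O K) (w : ι → ℝ) (i : ι) (j : ℕ) :
    Module.End K (analyticInduction k w) where
  toFun f := ⟨deltaFun hp i j f, deltaFun_mem hp i j f.2⟩
  map_add' _ _ := rfl
  map_smul' _ _ := rfl

/-- The intersection, over all `i` and all `1 ≤ j < a i`, of the sum of the generalized
eigenspaces of `δ_{i,j}` for the eigenvalues `t` of valuation smaller than `ν i j`. The valuation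
is normalized by `v(p) = 1`, so that `v(t) < ν` means `p ^ (-ν) < ‖t‖`. -/
noncomputable def smallSlope (k : Weight p a O K) (w : ι → ℝ) (ν : ι → ℕ → ℝ) :
    Submodule K (analyticInduction k w) :=
  ⨅ (i : ι) (j : ℕ) (_ : 1 ≤ j ∧ j < a i),
    ⨆ (t : K) (_ : (p : ℝ) ^ (-(ν i j)) < ‖t‖), (delta hp k w i j).maxGenEigenspace t

end Delta

/-! ### The algebraic representation -/

/-- The `R`-points of the algebraic group `∏ i, Res_{O i / ℤ_p} GL_{a i}`. -/
abbrev GLRes (R : Type u) [CommRing R] [Algebra ℤ_[p] R] :=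
  ∀ i, GL (Fin (a i)) (O i ⊗[ℤ_[p]] R)

/-- The `R`-points of its upper triangular Borel subgroup. -/
abbrev BorRes (R : Type u) [CommRing R] [Algebra ℤ_[p] R] :=
  ∀ i, borel (a i) (O i ⊗[ℤ_[p]] R)

variable {a O} in
/-- Functoriality of `GLRes`. -/
noncomputable def GLRes.map {R S : Type u} [CommRing R] [Algebra ℤ_[p] R] [CommRing S]
    [Algebra ℤ_[p] S] (φ : R →ₐ[ℤ_[p]] S) (g : GLRes p a O R) : GLRes p a O S := fun i =>
  Matrix.GeneralLinearGroup.map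
    ((Algebra.TensorProduct.map (AlgHom.id ℤ_[p] (O i)) φ : _ →ₐ[ℤ_[p]] _) :
      O i ⊗[ℤ_[p]] R →+* O i ⊗[ℤ_[p]] S) (g i)

variable {a O} in
/-- The map from the Iwahori subgroup to the `R`-points of the algebraic group. -/
noncomputable def Iw.toGLRes (R : Type u) [CommRing R] [Algebra ℤ_[p] R] (g : Iw p a O) :
    GLRes p a O R := fun i =>
  Matrix.GeneralLinearGroup.map
    ((Algebra.TensorProduct.includeLeft : O i →ₐ[ℤ_[p]] O i ⊗[ℤ_[p]] R) :
      O i →+* O i ⊗[ℤ_[p]] R) (g i)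

variable {p a O K} in
/-- The projection `O i ⊗ R → R`, `x ⊗ y ↦ τ(x) y`, attached to an embedding `τ`. -/
noncomputable def embRes (R : Type u) [CommRing R] [Algebra K R] [Algebra ℤ_[p] R]
    [IsScalarTower ℤ_[p] K R] {i : ι} (τ : O i →ₐ[ℤ_[p]] K) :
    O i ⊗[ℤ_[p]] R →ₐ[ℤ_[p]] R :=
  Algebra.TensorProduct.productMap ((IsScalarTower.toAlgHom ℤ_[p] K R).comp τ)
    (AlgHom.id ℤ_[p] R)

variable {p a O K} in
/-- The value on `R`-points of the algebraic character of weight `k` of the Borel subgroup. -/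
noncomputable def Weight.charRes [Fintype ι] [∀ i, Fintype (O i →ₐ[ℤ_[p]] K)]
    (R : Type u) [CommRing R] [Algebra K R] [Algebra ℤ_[p] R] [IsScalarTower ℤ_[p] K R] (k : Weight p a O K) (b : BorRes p a O R) : Rˣ :=
  ∏ i, ∏ τ : O i →ₐ[ℤ_[p]] K, ∏ j,
    Units.map (embRes R τ : O i ⊗[ℤ_[p]] R →* R) (diagUnit (b i) j) ^ k i τ j

/-- Morphisms of schemes over `K` from the base change to `K` of
`∏ i, Res_{O i / ℤ_p} GL_{a i}` to the affine line, given by their functors of points. -/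
structure RegularFunction where
  /-- The map on `R`-points. -/
  app : ∀ (R : Type u) [CommRing R] [Algebra K R] [Algebra ℤ_[p] R] [IsScalarTower ℤ_[p] K R],
    GLRes p a O R → R
  naturality : ∀ (R S : Type u) [CommRing R] [Algebra K R] [Algebra ℤ_[p] R]
    [IsScalarTower ℤ_[p] K R] [CommRing S] [Algebra K S] [Algebra ℤ_[p] S]
    [IsScalarTower ℤ_[p] K S] (φ : R →ₐ[K] S) (g : GLRes p a O R),
    app S (g.map p (φ.restrictScalars ℤ_[p])) = φ (app R g)

variable {p a O K} in
/-- The algebraic representation `V_χ` over `K`: regular functions `F` such that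
`F (g b) = χ(b) F(g)` on `R`-points, for all `K`-algebras `R`. -/
def algebraicInduction [Fintype ι] [∀ i, Fintype (O i →ₐ[ℤ_[p]] K)] (k : Weight p a O K) :
    Set (RegularFunction p a O K) :=
  {F | ∀ (R : Type u) [CommRing R] [Algebra K R] [Algebra ℤ_[p] R] [IsScalarTower ℤ_[p] K R]
    (g : GLRes p a O R) (b : BorRes p a O R),
    F.app R (g * fun i => (b i : GL (Fin (a i)) (O i ⊗[ℤ_[p]] R))) =
      (k.charRes R b : R) * F.app R g}

end Product

end Iwahoric

namespace Iwahoric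

/-! ### Monomials in the opposite unipotent coordinates as functions on `GL_n` -/

section Minors

variable {n : ℕ} {R : Type*} [CommRing R]

/-! Expand $f$ restricted to $N$ in a power series $\sum_\alpha c_\alpha y^\alpha$ at the identity.
Conjugation by $d_{i,j}$ multiplies some coordinates by $p$ and fixes the others, so $\delta_{i,j}$
multiplies $c_\alpha$ by $p^{d}$, where $d$ is the degree of $\alpha$ in the scaled coordinates
(`taylor_delta`). This needs the expansion to be unique (`coeff_eq_zero_of_hasSum`), which holds
because the points of $N$ span the coordinate space over $K$, by independence of the embeddings.

The functional $f \mapsto c_\alpha$ is thus an eigenvector of the transpose of $\delta_{i,j}$, and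
it kills every generalized eigenspace except the one for $p^d$. On the small slope part, $c_\alpha
\ne 0$ therefore forces $d < \nu_{i,j}$ for all $(i,j)$ (`scaledDeg_lt_of_taylor_ne_zero`). Every
coordinate is scaled by some $\delta_{i,j}$, so only finitely many $\alpha$ survive and $f$ is a
polynomial $P$ near the identity.

To get $f = P$ on all of $N$, note that suitable products of the conjugations contract $N$ into any
polydisc around the identity. The corresponding product of operators kills $f - P$, yet it is
injective on vectors in the finite slope parts of all the factors (`eq_zero_of_finiteSlope`).

Finally, column $c$ (counted from zero) below the diagonal is scaled by $\delta_{i,a_i-(c+1)}$. So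
for each embedding the degree of $\alpha$ in that column is less than $k_c - k_{c+1} + 1$, hence at
most $k_c - k_{c+1}$. This is exactly the condition for the monomial $y^\alpha$ to extend to a
regular function of weight $\chi$: a power of the determinant times minors on the first columns
(`monoFun_mul_borel`). -/

/-- The rows `0, …, c - 1, r`. -/
def minorRows (r c : Fin n) (s : Fin (c + 1)) : Fin n :=
  if (s : ℕ) < c then Fin.castLE c.isLt s else r

/-- The minor of `M` with rows `0, …, c - 1, r` and columns `0, …, c`. -/
def leadMinor (M : Matrix (Fin n) (Fin n) R) (r c : Fin n) : R :=
  (M.submatrix (minorRows r c) (Fin.castLE c.isLt)).det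

theorem map_leadMinor {S : Type*} [CommRing S] (φ : R →+* S) (M : Matrix (Fin n) (Fin n) R)
    (r c : Fin n) : φ (leadMinor M r c) = leadMinor (M.map φ) r c := by
  rw [leadMinor, RingHom.map_det]
  rfl

/-- As $b$ is upper triangular, the first $c+1$ columns of $Mb$ involve only the first $c+1$ columns
of $M$, so the submatrix factors. The character obtained depends on $c$ and not on $r$. -/
theorem leadMinor_mul_upper (M : Matrix (Fin n) (Fin n) R) {b : Matrix (Fin n) (Fin n) R}
    (hb : b.BlockTriangular id) (r c : Fin n) :
    leadMinor (M * b) r c = leadMinor M r c * ∏ j ∈ Finset.Iic c, b j j := by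
  have hinj : Function.Injective (Fin.castLE c.isLt : Fin (c + 1) → Fin n) :=
    Fin.castLE_injective _
  have h1 : (M * b).submatrix (minorRows r c) (Fin.castLE c.isLt) =
      M.submatrix (minorRows r c) (Fin.castLE c.isLt) *
        b.submatrix (Fin.castLE c.isLt) (Fin.castLE c.isLt) := by
    ext s t
    simp only [Matrix.submatrix_apply, Matrix.mul_apply]
    symm
    refine Finset.sum_of_injOn (Fin.castLE c.isLt) hinj.injOn (by simp) (fun l _ hl => ?_)
      (fun _ _ => rfl)
    have hcl : (c : ℕ) < l := by
      by_contra hlc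
      exact hl ⟨⟨l, by omega⟩, by simp, rfl⟩
    have htl : Fin.castLE c.isLt t < l := by
      rw [Fin.lt_def, Fin.val_castLE]
      omega
    have hbl : b l (Fin.castLE c.isLt t) = 0 := hb htl
    exact (congrArg (M (minorRows r c s) l * ·) hbl).trans (mul_zero _)
  have h2 : (b.submatrix (Fin.castLE c.isLt) (Fin.castLE c.isLt)).BlockTriangular id :=
    fun s t hst => hb (show Fin.castLE c.isLt t < Fin.castLE c.isLt s from hst)
  rw [leadMinor, h1, Matrix.det_mul, Matrix.det_of_isUpperTriangular h2]
  congr 1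
  refine Finset.prod_of_injOn (Fin.castLE c.isLt) hinj.injOn (fun s _ => ?_) (fun l hl hl' => ?_)
    (fun _ _ => rfl)
  · rw [Finset.coe_Iic, Set.mem_Iic, Fin.le_def, Fin.val_castLE]
    omega
  · rw [Finset.mem_Iic, Fin.le_def] at hl
    exact absurd ⟨⟨l, by omega⟩, by simp, rfl⟩ hl'

/-- The submatrix is again lower triangular; its diagonal is $1, \dots, 1, M_{rc}$. -/
theorem leadMinor_of_unipotent {M : Matrix (Fin n) (Fin n) R} (h0 : ∀ r c, r < c → M r c = 0)
    (h1 : ∀ r, M r r = 1) (r c : Fin n) : leadMinor M r c = M r c := by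
  rw [leadMinor, Matrix.det_of_isLowerTriangular, Fin.prod_univ_castSucc,
    Finset.prod_eq_one, one_mul]
  · simp only [Matrix.submatrix_apply, minorRows, Fin.val_last, lt_irrefl, if_false]
    rfl
  · intro s _
    simp only [Matrix.submatrix_apply, minorRows, Fin.val_castSucc, s.isLt, if_true, h1]
  · intro s t hst
    have hst' : s < t := hst
    have hs : (s : ℕ) < c := by omega
    simp only [Matrix.submatrix_apply, minorRows, hs, if_true]
    exact h0 _ _ hst'

/-- The last entry of a weight, zero if the weight is empty. -/
def lastWeight (k : Fin n → ℤ) : ℤ := if h : 0 < n then k ⟨n - 1, by omega⟩ else 0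

/-- The pairing of a weight with the simple coroot in the positions `c`, `c + 1`. -/
def gap (k : Fin n → ℤ) (c : Fin n) : ℤ :=
  if h : (c : ℕ) + 1 < n then k c - k ⟨c + 1, h⟩ else 0

/-- Telescoping sum; the value $0$ of `gap` at the last position makes it stop at `lastWeight`. -/
theorem lastWeight_add_sum_gap (k : Fin n → ℤ) (j : Fin n) :
    lastWeight k + ∑ c ∈ Finset.Ici j, gap k c = k j := by
  obtain ⟨d, hd⟩ : ∃ d : ℕ, (j : ℕ) + d + 1 = n := ⟨n - 1 - j, by omega⟩
  induction d generalizing j with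
  | zero =>
    have h1 : Finset.Ioi j = ∅ := by
      ext c
      simp only [Finset.mem_Ioi, Fin.lt_def, Finset.notMem_empty, iff_false]
      omega
    have h2 : (⟨n - 1, by omega⟩ : Fin n) = j := Fin.ext (by simp only; omega)
    rw [← Finset.Ioi_insert, h1, Finset.sum_insert (by simp), Finset.sum_empty, gap,
      dif_neg (by omega), lastWeight, dif_pos (by omega), h2]
    simp
  | succ d ih =>
    have hj : (j : ℕ) + 1 < n := by omega
    have h1 : Finset.Ioi j = Finset.Ici ⟨j + 1, hj⟩ := by
      ext c
      simp only [Finset.mem_Ioi, Finset.mem_Ici, Fin.lt_def, Fin.le_def]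
      omega
    have h2 := ih ⟨j + 1, hj⟩ (by simp only; omega)
    rw [← Finset.Ioi_insert, Finset.sum_insert (by simp), h1, gap, dif_pos hj]
    linarith

/-- The degree of a monomial in the coordinates of the column `c`. -/
def colDeg (α : {x : Fin n × Fin n // x.2 < x.1} → ℕ) (c : Fin n) : ℕ :=
  ∑ x with x.1.2 = c, α x

theorem colDeg_eq_zero (α : {x : Fin n × Fin n // x.2 < x.1} → ℕ) {c : Fin n}
    (hc : ¬ (c : ℕ) + 1 < n) : colDeg α c = 0 := by
  refine Finset.sum_eq_zero fun x hx => ?_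
  have h1 : x.1.2 = c := (Finset.mem_filter.1 hx).2
  have h2 := x.2
  rw [h1, Fin.lt_def] at h2
  omega

/-- The extension of the monomial `α` in the lower triangular unipotent coordinates to a function
on `GL_n(R)` that transforms under the upper triangular Borel subgroup by the weight `k`. -/
noncomputable def monoFun (k : Fin n → ℤ) (α : {x : Fin n × Fin n // x.2 < x.1} → ℕ)
    (g : GL (Fin n) R) : R :=
  ((Matrix.GeneralLinearGroup.det g ^ lastWeight k : Rˣ) : R) *
    (∏ c, leadMinor (g : Matrix (Fin n) (Fin n) R) c c ^ (gap k c - colDeg α c).toNat) *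
    ∏ x, leadMinor (g : Matrix (Fin n) (Fin n) R) x.1.1 x.1.2 ^ α x

theorem map_monoFun {S : Type*} [CommRing S] (φ : R →+* S) (k : Fin n → ℤ)
    (α : {x : Fin n × Fin n // x.2 < x.1} → ℕ) (g : GL (Fin n) R) :
    φ (monoFun k α g) = monoFun k α (Matrix.GeneralLinearGroup.map φ g) := by
  have h : φ ((Matrix.GeneralLinearGroup.det g ^ lastWeight k : Rˣ) : R) =
      ((Matrix.GeneralLinearGroup.det (Matrix.GeneralLinearGroup.map φ g) ^ lastWeight k : Sˣ) :
        S) := by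
    have h1 : Matrix.GeneralLinearGroup.det (Matrix.GeneralLinearGroup.map φ g) =
        Units.map (φ : R →* S) (Matrix.GeneralLinearGroup.det g) := by
      apply Units.ext
      simp only [Matrix.GeneralLinearGroup.val_det_apply, Units.coe_map, MonoidHom.coe_coe,
        RingHom.map_det]
      rfl
    rw [h1, ← map_zpow (Units.map (φ : R →* S))]
    rfl
  simp only [monoFun, map_mul, map_prod, map_pow, map_leadMinor, h]
  rfl

theorem monoFun_of_unipotent (k : Fin n → ℤ) (α : {x : Fin n × Fin n // x.2 < x.1} → ℕ)
    {g : GL (Fin n) R} (h0 : ∀ r c, r < c → g r c = 0) (h1 : ∀ r, g r r = 1) :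
    monoFun k α g = ∏ x, g x.1.1 x.1.2 ^ α x := by
  have hdet : Matrix.GeneralLinearGroup.det g = 1 := by
    apply Units.ext
    rw [Matrix.GeneralLinearGroup.val_det_apply,
      Matrix.det_of_isLowerTriangular _ (fun r c h => h0 r c h)]
    simp [h1]
  simp only [monoFun, hdet, leadMinor_of_unipotent h0 h1, h1]
  simp

/-- Summation by parts: $\beta_j$ occurs in the partial products with $c \ge j$, so its total
exponent is $k_j$ by telescoping. This writes the weight in terms of fundamental weights. -/
theorem prod_Iic_pow_gap {G : Type*} [CommGroup G] (k : Fin n → ℤ) (β : Fin n → G) :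
    (∏ j, β j) ^ lastWeight k * ∏ c, (∏ j ∈ Finset.Iic c, β j) ^ gap k c = ∏ j, β j ^ k j := by
  have h : ∏ c, (∏ j ∈ Finset.Iic c, β j) ^ gap k c =
      ∏ j, β j ^ ∑ c ∈ Finset.Ici j, gap k c := by
    have h2 : ∀ (j : Fin n) (s : Finset (Fin n)),
        β j ^ ∑ c ∈ s, gap k c = ∏ c ∈ s, β j ^ gap k c := fun j s => by
      classical
      induction s using Finset.induction_on with
      | empty => simp
      | insert c s hc ih => rw [Finset.sum_insert hc, Finset.prod_insert hc, _root_.zpow_add, ih]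
    simp only [← Finset.prod_zpow, h2]
    exact Finset.prod_comm' (by simp)
  rw [h, ← Finset.prod_zpow, ← Finset.prod_mul_distrib]
  refine Finset.prod_congr rfl fun j _ => ?_
  rw [← _root_.zpow_add, lastWeight_add_sum_gap]

/-- The minors $(r,c)$ and $(c,c)$ transform by the same character, so trading `colDeg α c` of the
`gap k c` factors of the principal minor for other minors of column $c$ preserves the weight. -/
theorem monoFun_mul_borel (k : Fin n → ℤ) (α : {x : Fin n × Fin n // x.2 < x.1} → ℕ)
    (hα : ∀ c, (colDeg α c : ℤ) ≤ gap k c) (g : GL (Fin n) R) (b : borel n R) :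
    monoFun k α (g * (b : GL (Fin n) R)) =
      ((∏ j, diagUnit b j ^ k j : Rˣ) : R) * monoFun k α g := by
  have hdet : Matrix.GeneralLinearGroup.det (g * (b : GL (Fin n) R)) =
      Matrix.GeneralLinearGroup.det g * ∏ j, diagUnit b j := by
    rw [map_mul]
    congr 1
    apply Units.ext
    rw [Matrix.GeneralLinearGroup.val_det_apply, Matrix.det_of_isUpperTriangular b.2,
      Units.coe_prod]
    rfl
  let B : Fin n → Rˣ := fun c => ∏ j ∈ Finset.Iic c, diagUnit b j
  have hm : ∀ r c, leadMinor ((g * (b : GL (Fin n) R) : GL (Fin n) R) :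
      Matrix (Fin n) (Fin n) R) r c =
      leadMinor (g : Matrix (Fin n) (Fin n) R) r c * (B c : R) := by
    intro r c
    rw [Units.val_mul, leadMinor_mul_upper _ b.2, Units.coe_prod]
    rfl
  have hB : (∏ j, diagUnit b j) ^ lastWeight k *
      (∏ c, B c ^ (gap k c - colDeg α c).toNat) * (∏ x, B x.1.2 ^ α x) =
      ∏ j, diagUnit b j ^ k j := by
    have h1 : ∏ x, B x.1.2 ^ α x = ∏ c, B c ^ colDeg α c := by
      rw [← Finset.prod_fiberwise Finset.univ
        (fun x : {x : Fin n × Fin n // x.2 < x.1} => x.1.2)]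
      refine Finset.prod_congr rfl fun c _ => ?_
      rw [colDeg, ← Finset.prod_pow_eq_pow_sum]
      refine Finset.prod_congr rfl fun x hx => ?_
      rw [(Finset.mem_filter.1 hx).2]
    rw [h1, mul_assoc, ← Finset.prod_mul_distrib, ← prod_Iic_pow_gap]
    congr 1
    refine Finset.prod_congr rfl fun c _ => ?_
    rw [← pow_add, ← zpow_natCast]
    congr 1
    -- The degree bound is what keeps `toNat` from truncating the exponent.
    have := hα c
    push_cast
    rw [Int.toNat_of_nonneg (by omega)]
    ring
  simp only [monoFun, hdet, hm, mul_pow, Finset.prod_mul_distrib, mul_zpow]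
  rw [← hB]
  simp only [Units.val_mul, Units.coe_prod, Units.val_pow_eq_pow_val]
  ring

end Minors

/-! ### Regular functions attached to polynomials in the opposite unipotent coordinates -/

section Regular

variable {p : ℕ} [Fact p.Prime] {ι : Type w} {a : ι → ℕ}
  {O : ι → Type v} [∀ i, CommRing (O i)] [∀ i, Algebra ℤ_[p] (O i)]
  {K : Type u} [NormedField K] [NormedAlgebra ℚ_[p] K] [Algebra ℤ_[p] K]

/-- The projection of an `R`-point of the algebraic group to the factor `GL_{a i}(R)` attached to
an embedding `τ`. -/
noncomputable def GLRes.proj {R : Type u} [CommRing R] [Algebra K R] [Algebra ℤ_[p] R]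
    [IsScalarTower ℤ_[p] K R] (g : GLRes p a O R) {i : ι} (τ : O i →ₐ[ℤ_[p]] K) :
    GL (Fin (a i)) R :=
  Matrix.GeneralLinearGroup.map (embRes R τ : O i ⊗[ℤ_[p]] R →+* R) (g i)

theorem embRes_map {R S : Type u} [CommRing R] [Algebra K R] [Algebra ℤ_[p] R]
    [IsScalarTower ℤ_[p] K R] [CommRing S] [Algebra K S] [Algebra ℤ_[p] S]
    [IsScalarTower ℤ_[p] K S] (φ : R →ₐ[K] S) {i : ι} (τ : O i →ₐ[ℤ_[p]] K)
    (x : O i ⊗[ℤ_[p]] R) :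
    embRes S τ (Algebra.TensorProduct.map (AlgHom.id ℤ_[p] (O i)) (φ.restrictScalars ℤ_[p]) x) =
      φ (embRes R τ x) := by
  induction x using TensorProduct.induction_on with
  | zero => simp
  | tmul x y => simp [embRes]
  | add x y hx hy => rw [map_add, map_add, hx, hy, map_add, map_add]

theorem GLRes.proj_map {R S : Type u} [CommRing R] [Algebra K R] [Algebra ℤ_[p] R]
    [IsScalarTower ℤ_[p] K R] [CommRing S] [Algebra K S] [Algebra ℤ_[p] S]
    [IsScalarTower ℤ_[p] K S] (φ : R →ₐ[K] S) (g : GLRes p a O R) {i : ι}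
    (τ : O i →ₐ[ℤ_[p]] K) :
    (g.map p (φ.restrictScalars ℤ_[p])).proj τ =
      Matrix.GeneralLinearGroup.map (φ : R →+* S) (g.proj τ) := by
  apply Units.ext
  ext r c
  exact embRes_map φ τ (g i r c)

variable [Fintype ι] [∀ i, Fintype (O i →ₐ[ℤ_[p]] K)]

/-- The regular function of weight `k` that extends the polynomial with coefficients `c α`, for
`α` in `s`, in the opposite unipotent coordinates. -/
noncomputable def polyFun (k : Weight p a O K) (s : Finset (Coord p a O K →₀ ℕ))
    (c : (Coord p a O K →₀ ℕ) → K) : RegularFunction p a O K where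
  app R _ _ _ _ g := ∑ α ∈ s, algebraMap K R (c α) *
    ∏ i, ∏ τ : O i →ₐ[ℤ_[p]] K, monoFun (k i τ) (fun x => α ⟨i, τ, x⟩) (g.proj τ)
  naturality R S _ _ _ _ _ _ _ _ φ g := by
    simp only [map_sum, map_mul, map_prod, AlgHom.commutes, GLRes.proj_map]
    refine Finset.sum_congr rfl fun α _ => ?_
    congr 1
    refine Finset.prod_congr rfl fun i _ => Finset.prod_congr rfl fun τ _ => ?_
    exact (map_monoFun (φ : R →+* S) _ _ _).symm

theorem polyFun_mem_algebraicInduction {k : Weight p a O K} {s : Finset (Coord p a O K →₀ ℕ)}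
    (c : (Coord p a O K →₀ ℕ) → K)
    (hs : ∀ α ∈ s, ∀ i (τ : O i →ₐ[ℤ_[p]] K) (j : Fin (a i)),
      (colDeg (fun x => α ⟨i, τ, x⟩) j : ℤ) ≤ gap (k i τ) j) :
    polyFun k s c ∈ algebraicInduction k := by
  intro R _ _ _ _ g b
  simp only [polyFun, Finset.mul_sum]
  refine Finset.sum_congr rfl fun α hα => ?_
  rw [mul_left_comm]
  congr 1
  rw [Weight.charRes, Units.coe_prod, ← Finset.prod_mul_distrib]
  refine Finset.prod_congr rfl fun i _ => ?_
  rw [Units.coe_prod, ← Finset.prod_mul_distrib]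
  refine Finset.prod_congr rfl fun τ _ => ?_
  let φ : O i ⊗[ℤ_[p]] R →+* R := (embRes R τ : O i ⊗[ℤ_[p]] R →+* R)
  -- Each embedding gives a projection to $\mathrm{GL}_{a_i}(R)$ that preserves the Borel subgroup,
  -- so equivariance can be checked one factor at a time.
  let b' : borel (a i) R := ⟨Matrix.GeneralLinearGroup.map φ (b i), fun r c hrc => by
    have h : (b i : GL (Fin (a i)) (O i ⊗[ℤ_[p]] R)) r c = 0 := (b i).2 hrc
    exact (congrArg φ h).trans (map_zero φ)⟩
  have h1 : GLRes.proj (g * fun i => (b i : GL (Fin (a i)) (O i ⊗[ℤ_[p]] R))) τ =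
      g.proj τ * (b' : GL (Fin (a i)) R) :=
    map_mul (Matrix.GeneralLinearGroup.map φ) _ _
  have h2 : ∀ j, diagUnit b' j =
      Units.map (embRes R τ : O i ⊗[ℤ_[p]] R →* R) (diagUnit (b i) j) :=
    fun j => Units.ext rfl
  rw [h1, monoFun_mul_borel _ _ (hs α hα i τ)]
  simp only [h2]

theorem charRes_toGLRes [IsScalarTower ℤ_[p] ℚ_[p] K] (k : Weight p a O K) (b : Bor a O) :
    ∃ b' : BorRes p a O K, (b.toIw p).toGLRes p K = (fun i => (b' i : GL _ _)) ∧
      k.charRes K b' = k.char b := by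
  let φ : ∀ i, O i →+* O i ⊗[ℤ_[p]] K := fun i =>
    ((Algebra.TensorProduct.includeLeft : O i →ₐ[ℤ_[p]] O i ⊗[ℤ_[p]] K) :
      O i →+* O i ⊗[ℤ_[p]] K)
  refine ⟨fun i => ⟨Matrix.GeneralLinearGroup.map (φ i) (b i), fun r c hrc => ?_⟩, rfl, ?_⟩
  · have h : (b i : GL (Fin (a i)) (O i)) r c = 0 := (b i).2 hrc
    exact (congrArg (φ i) h).trans (map_zero (φ i))
  · refine Finset.prod_congr rfl fun i _ => Finset.prod_congr rfl fun τ _ =>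
      Finset.prod_congr rfl fun j _ => ?_
    congr 1
    apply Units.ext
    change embRes K τ ((b i : GL (Fin (a i)) (O i)) j j ⊗ₜ[ℤ_[p]] (1 : K)) =
      τ ((b i : GL (Fin (a i)) (O i)) j j)
    simp [embRes]

theorem polyFun_toIw (k : Weight p a O K) (s : Finset (Coord p a O K →₀ ℕ))
    (c : (Coord p a O K →₀ ℕ) → K) (l : Nop p a O) :
    (polyFun k s c).app K ((l.toIw p).toGLRes p K) =
      ∑ α ∈ s, c α * α.prod fun e m => l.coord e ^ m := by
  refine Finset.sum_congr rfl fun α _ => ?_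
  rw [Finsupp.prod_fintype _ _ (by simp), Fintype.prod_sigma]
  congr 1
  refine Finset.prod_congr rfl fun i _ => ?_
  rw [Fintype.prod_prod_type]
  refine Finset.prod_congr rfl fun τ _ => ?_
  have h : ∀ r c, ((l.toIw p).toGLRes p K).proj τ r c = τ ((l i : GL (Fin (a i)) (O i)) r c) := by
    intro r c
    change embRes K τ ((l i : GL (Fin (a i)) (O i)) r c ⊗ₜ[ℤ_[p]] (1 : K)) = _
    simp [embRes]
  have hl := (mem_nop_iff p).1 (l i).2
  rw [monoFun_of_unipotent]
  · exact Finset.prod_congr rfl fun x _ => by rw [h]; rfl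
  · intro r c hrc
    rw [h, hl.1 r c hrc, map_zero]
  · intro r
    rw [h, hl.2.1, map_one]

/-- A function that is equivariant of weight `k` and is given on `Nop` by a polynomial is the
restriction of the corresponding regular function. -/
theorem eq_polyFun [IsScalarTower ℤ_[p] ℚ_[p] K] [∀ i, IsLocalRing (O i)]
    (hp : ∀ i, Irreducible (p : O i)) {k : Weight p a O K} {s : Finset (Coord p a O K →₀ ℕ)}
    {c : (Coord p a O K →₀ ℕ) → K} (hF : polyFun k s c ∈ algebraicInduction k)
    {f : Iw p a O → K} (hf : ∀ g (b : Bor a O), f (g * b.toIw p) = (k.char b : K) * f g)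
    (hfs : ∀ l : Nop p a O, f (l.toIw p) = ∑ α ∈ s, c α * α.prod fun e m => l.coord e ^ m)
    (g : Iw p a O) : f g = (polyFun k s c).app K (g.toGLRes p K) := by
  obtain ⟨b', hb', hk⟩ := charRes_toGLRes k (bPart hp g)
  -- Both sides transform by $\chi$ under the Borel part of $g = nb$, so it is enough to compare
  -- them at $n$.
  rw [← nPart_mul_bPart hp g, hf, hfs, ← polyFun_toIw k, ← hk, ← hF K, ← hb']
  congr 1
  funext i
  exact (map_mul (Matrix.GeneralLinearGroup.map _) _ _).symm

end Regular

/-! ### Uniqueness of power series expansions on `Nop` -/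

section Uniqueness

/-- Uniqueness of one-variable power series at a point, valid over any nontrivially normed field. -/
theorem coeff_eq_zero_of_eventually_hasSum {𝕜 E : Type*} [NontriviallyNormedField 𝕜]
    [NormedAddCommGroup E] [NormedSpace 𝕜 E] {c : ℕ → E}
    (h : ∀ᶠ s in 𝓝 (0 : 𝕜), HasSum (fun m => s ^ m • c m) 0) (m : ℕ) : c m = 0 := by
  let P : FormalMultilinearSeries 𝕜 𝕜 E := fun m =>
    ContinuousMultilinearMap.mkPiRing 𝕜 (Fin m) (c m)
  have hP : ∀ m, P.coeff m = c m := fun m => by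
    simp [FormalMultilinearSeries.coeff, P]
  have h1 : HasFPowerSeriesAt (0 : 𝕜 → E) P 0 := by
    rw [hasFPowerSeriesAt_iff]
    simpa only [hP, Pi.zero_apply] using h
  rw [← hP, h1.eq_zero]
  rfl

/-- The homogeneous components of a multivariate power series with sum zero near the origin of a
line through the origin vanish on this line. -/
theorem sum_degree_eq_zero {𝕜 K σ : Type*} [NontriviallyNormedField 𝕜] [NormedField K]
    [CompleteSpace K] [NormedAlgebra 𝕜 K] [Fintype σ] [DecidableEq σ] {c : (σ →₀ ℕ) → K}
    {v : σ → K}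
    (h : ∀ᶠ s in 𝓝 (0 : 𝕜), HasSum (fun α => c α * α.prod fun e m => (s • v e) ^ m) 0) (m : ℕ) :
    ∑ α ∈ Finset.finsuppAntidiag Finset.univ m, c α * α.prod (fun e m => v e ^ m) = 0 := by
  refine coeff_eq_zero_of_eventually_hasSum (𝕜 := 𝕜) (c := fun m =>
    ∑ α ∈ Finset.finsuppAntidiag Finset.univ m, c α * α.prod (fun e m => v e ^ m)) ?_ m
  filter_upwards [h] with s hs
  -- Grouped by total degree, the series on the line becomes a one-variable series in $s$, whose
  -- $m$-th coefficient is the degree $m$ form at $v$.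
  convert hs.tsum_fiberwise Finsupp.degree using 2 with m
  have hset : Finsupp.degree ⁻¹' {m} =
      ((Finset.finsuppAntidiag Finset.univ m : Finset (σ →₀ ℕ)) : Set (σ →₀ ℕ)) := by
    ext α
    simp [Finset.mem_finsuppAntidiag, Finsupp.degree_eq_sum]
  rw [hset, Finset.tsum_subtype' _
    (fun α : σ →₀ ℕ => c α * α.prod fun e m => (s • v e) ^ m), Finset.smul_sum]
  refine Finset.sum_congr rfl fun α hα => ?_
  have hdeg : ∑ e, α e = m := (Finset.mem_finsuppAntidiag.1 hα).1
  rw [Finsupp.prod_fintype _ _ (by simp), Finsupp.prod_fintype _ _ (by simp)]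
  simp only [Algebra.smul_def, mul_pow, Finset.prod_mul_distrib, Finset.prod_pow_eq_pow_sum, hdeg,
    map_pow]
  ring

/-- A polynomial over a field of characteristic zero that vanishes on a set closed under addition
that spans the space vanishes. -/
theorem mvPolynomial_eq_zero_of_span {K σ : Type*} [Field K] [CharZero K]
    {S : AddSubmonoid (σ → K)} (hS : Submodule.span K (S : Set (σ → K)) = ⊤)
    {Q : MvPolynomial σ K} (h : ∀ v ∈ S, MvPolynomial.eval v Q = 0) : Q = 0 := by
  refine MvPolynomial.funext fun v => ?_
  rw [map_zero]
  obtain ⟨n, x, s, rfl⟩ := Submodule.mem_span_set'.1 (hS ▸ Submodule.mem_top : v ∈ _)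
  -- Pull $Q$ back to the span of finitely many vectors of $S$ whose combination is $v$.
  let Q' : MvPolynomial (Fin n) K := MvPolynomial.aeval
    (fun e => ∑ j, MvPolynomial.C ((s j : σ → K) e) * MvPolynomial.X j) Q
  have hQ' : ∀ y : Fin n → K, MvPolynomial.eval y Q' =
      MvPolynomial.eval (∑ j, y j • (s j : σ → K)) Q := by
    intro y
    have h1 := MvPolynomial.comp_aeval_apply
      (fun e => ∑ j, MvPolynomial.C ((s j : σ → K) e) * MvPolynomial.X j)
      (MvPolynomial.aeval y : MvPolynomial (Fin n) K →ₐ[K] K) Q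
    rw [← MvPolynomial.coe_aeval_eq_eval, ← MvPolynomial.coe_aeval_eq_eval]
    have h2 : (fun e => MvPolynomial.aeval y (∑ j, MvPolynomial.C ((s j : σ → K) e) *
        MvPolynomial.X j : MvPolynomial (Fin n) K)) = ∑ j, y j • (s j : σ → K) := by
      funext e
      simp [mul_comm]
    rw [← h2]
    exact h1
  have hz : Q' = 0 := by
    -- Combinations with natural number coefficients stay in $S$, and the image of $\mathbb N$ in
    -- $K$ is infinite, so it is large enough to test $Q'$.
    refine MvPolynomial.funext_set (fun _ => Set.range ((↑) : ℕ → K))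
      (fun _ => Set.infinite_range_of_injective Nat.cast_injective) fun y hy => ?_
    choose z hz using fun j => hy j (Set.mem_univ j)
    rw [hQ', map_zero]
    refine h _ (sum_mem fun j _ => ?_)
    rw [← hz j, Nat.cast_smul_eq_nsmul]
    exact nsmul_mem (s j).2 _
  rw [← hQ', hz, map_zero]

variable {p : ℕ} [Fact p.Prime] {ι : Type w} {a : ι → ℕ}
  {O : ι → Type v} [∀ i, CommRing (O i)] [∀ i, Algebra ℤ_[p] (O i)]
  {K : Type u} [NormedField K] [NormedAlgebra ℚ_[p] K] [Algebra ℤ_[p] K]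

/-- The element of `Nop` with entries `p u` below the diagonal. -/
noncomputable def Nop.ofEntries (u : ∀ i, {x : Fin (a i) × Fin (a i) // x.2 < x.1} → O i) :
    Nop p a O := fun i =>
  ⟨lowerMk (Matrix.of fun r c => if h : c < r then (p : O i) * u i ⟨(r, c), h⟩ else
      if r = c then 1 else 0)
    (fun r c h => by simp [h.not_gt, h.ne]) (fun r => by simp), by
    rw [mem_nop_iff]
    refine ⟨fun r c h => ?_, fun r => ?_, fun r c h => ?_⟩
    · simp [h.not_gt, h.ne]
    · simp
    · simp only [lowerMk_apply, Matrix.of_apply, dif_pos h]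
      exact dvd_mul_right _ _⟩

variable (p a O K) in
/-- The coordinates of the elements `Nop.ofEntries u`, as an additive function of `u`. -/
noncomputable def entriesCoord :
    (∀ i, {x : Fin (a i) × Fin (a i) // x.2 < x.1} → O i) →+ (Coord p a O K → K) where
  toFun u e := (p : K) * e.2.1 (u e.1 e.2.2)
  map_zero' := by
    funext e
    simp
  map_add' u u' := by
    funext e
    simp [mul_add]

theorem coord_ofEntries (u : ∀ i, {x : Fin (a i) × Fin (a i) // x.2 < x.1} → O i)
    (e : Coord p a O K) : (Nop.ofEntries u : Nop p a O).coord e = entriesCoord p a O K u e := by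
  obtain ⟨i, τ, ⟨⟨r, c⟩, h⟩⟩ := e
  have h' : c < r := h
  simp [Nop.coord, Nop.ofEntries, entriesCoord, h']

theorem entriesCoord_smul [IsScalarTower ℤ_[p] ℚ_[p] K] (s : ℤ_[p])
    (u : ∀ i, {x : Fin (a i) × Fin (a i) // x.2 < x.1} → O i) (e : Coord p a O K) :
    entriesCoord p a O K (s • u) e = (s : ℚ_[p]) • entriesCoord p a O K u e := by
  have h : ((s : ℚ_[p]) • entriesCoord p a O K u e : K) = s • entriesCoord p a O K u e :=
    algebraMap_smul ℚ_[p] s (entriesCoord p a O K u e)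
  rw [h]
  simp [entriesCoord]

/-- A nonzero functional vanishing on these vectors, tested on $u$ supported at one block and one
position, would give a nontrivial linear relation among the embeddings of $\mathcal O_i$, against
Dedekind's independence of characters. -/
theorem span_entriesCoord [DecidableEq ι] [Fintype ι] [∀ i, Fintype (O i →ₐ[ℤ_[p]] K)] :
    Submodule.span K ((AddMonoidHom.mrange (entriesCoord p a O K) :
      AddSubmonoid (Coord p a O K → K)) : Set (Coord p a O K → K)) = ⊤ := by
  classical
  by_contra hne
  obtain ⟨φ, hφ, hle⟩ := Submodule.exists_le_ker_of_lt_top _ (lt_top_iff_ne_top.2 hne)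
  have hp0 : (p : K) ≠ 0 := by
    rw [← map_natCast (algebraMap ℚ_[p] K) p, map_ne_zero]
    exact_mod_cast (Fact.out : p.Prime).ne_zero
  refine hφ (LinearMap.pi_ext' fun e => LinearMap.ext_ring ?_)
  obtain ⟨i, τ, x⟩ := e
  have hli : LinearIndependent K fun τ : O i →ₐ[ℤ_[p]] K => ((τ : O i →* K) : O i → K) :=
    (linearIndependent_monoidHom (O i) K).comp (fun τ : O i →ₐ[ℤ_[p]] K => (τ : O i →* K))
      fun τ τ' h => AlgHom.ext fun y => DFunLike.congr_fun h y
  rw [Fintype.linearIndependent_iff] at hli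
  refine hli (fun τ => φ (Pi.single ⟨i, τ, x⟩ 1)) ?_ τ
  funext y
  let u : ∀ i, {x : Fin (a i) × Fin (a i) // x.2 < x.1} → O i := Pi.single i (Pi.single x y)
  have hu : φ (entriesCoord p a O K u) = 0 := hle (Submodule.subset_span ⟨u, rfl⟩)
  have hu' : entriesCoord p a O K u =
      ∑ τ : O i →ₐ[ℤ_[p]] K, ((p : K) * τ y) • Pi.single (⟨i, τ, x⟩ : Coord p a O K) (1 : K) := by
    funext e
    obtain ⟨i', τ', x'⟩ := e
    rw [Finset.sum_apply]
    by_cases hi : i' = i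
    · subst hi
      by_cases hx : x' = x
      · subst hx
        rw [Finset.sum_eq_single τ']
        · simp [entriesCoord, u]
        · intro τ _ hτ
          rw [Pi.smul_apply, Pi.single_eq_of_ne, smul_zero]
          simpa using hτ.symm
        · simp
      · rw [Finset.sum_eq_zero]
        · simp [entriesCoord, u, hx]
        · intro τ _
          rw [Pi.smul_apply, Pi.single_eq_of_ne, smul_zero]
          simp [hx]
    · rw [Finset.sum_eq_zero]
      · simp [entriesCoord, u, hi]
      · intro τ _
        rw [Pi.smul_apply, Pi.single_eq_of_ne, smul_zero]
        simp [hi]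
  rw [hu', map_sum] at hu
  simp only [map_smul, smul_eq_mul, mul_assoc, ← Finset.mul_sum] at hu
  have := (mul_eq_zero.1 hu).resolve_left hp0
  simpa [mul_comm] using this

/-- The coefficients of a power series that vanishes at the points of `Nop` in a polydisc centred
at the identity are zero. -/
theorem coeff_eq_zero_of_hasSum [IsScalarTower ℤ_[p] ℚ_[p] K] [CompleteSpace K]
    [DecidableEq ι] [Fintype ι] [∀ i, Fintype (O i →ₐ[ℤ_[p]] K)]
    {c : (Coord p a O K →₀ ℕ) → K} {ρ : Coord p a O K → ℝ} (hρ : ∀ e, 0 < ρ e)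
    (h : ∀ y : Nop p a O, (∀ e : Coord p a O K, ‖y.coord e‖ ≤ ρ e) →
      HasSum (fun α : Coord p a O K →₀ ℕ => c α * α.prod fun e m => y.coord e ^ m) 0)
    (α : Coord p a O K →₀ ℕ) : c α = 0 := by
  classical
  have : CharZero K := charZero_of_injective_algebraMap (algebraMap ℚ_[p] K).injective
  -- The homogeneous components vanish on all coordinate vectors of the points `Nop.ofEntries u`,
  -- and these vectors form a spanning additive submonoid.
  let Q : ℕ → MvPolynomial (Coord p a O K) K := fun m =>
    ∑ α ∈ Finset.finsuppAntidiag Finset.univ m, MvPolynomial.monomial α (c α)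
  have hQ : ∀ m, Q m = 0 := by
    intro m
    refine mvPolynomial_eq_zero_of_span span_entriesCoord ?_
    rintro _ ⟨u, rfl⟩
    simp only [Q, map_sum, MvPolynomial.eval_monomial]
    refine sum_degree_eq_zero (𝕜 := ℚ_[p]) ?_ m
    have h1 : ∀ᶠ s in 𝓝 (0 : ℚ_[p]), ∀ e, ‖s • entriesCoord p a O K u e‖ < ρ e := by
      rw [eventually_all]
      intro e
      have h2 : Tendsto (fun s : ℚ_[p] => ‖s • entriesCoord p a O K u e‖) (𝓝 0) (𝓝 0) := by
        have h3 : Continuous fun s : ℚ_[p] => ‖s • entriesCoord p a O K u e‖ := by fun_prop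
        simpa using h3.tendsto 0
      exact h2.eventually_lt_const (hρ e)
    have h2 : ∀ᶠ s in 𝓝 (0 : ℚ_[p]), ‖s‖ < 1 := by
      have := (continuous_norm (E := ℚ_[p])).tendsto 0
      rw [norm_zero] at this
      exact this.eventually_lt_const one_pos
    -- A small $s \in \mathbb Q_p$ is a $p$-adic integer, so $s$ times the coordinate vector again
    -- comes from a point of $N$, which lies in the polydisc.
    filter_upwards [h1, h2] with s hs hs1
    let t : ℤ_[p] := ⟨s, hs1.le⟩
    have hc : ∀ e : Coord p a O K, (Nop.ofEntries (t • u) : Nop p a O).coord e =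
        s • entriesCoord p a O K u e := fun e => by
      rw [coord_ofEntries, entriesCoord_smul t]
    have := h (Nop.ofEntries (t • u)) fun e => by
      rw [hc]
      exact (hs e).le
    simpa only [hc] using this
  have h1 := congrArg (MvPolynomial.coeff α) (hQ (∑ e, α e))
  simp only [Q, MvPolynomial.coeff_sum, MvPolynomial.coeff_monomial, MvPolynomial.coeff_zero] at h1
  rwa [Finset.sum_ite_eq' , if_pos] at h1
  rw [Finset.mem_finsuppAntidiag]
  exact ⟨rfl, Finset.subset_univ _⟩

end Uniqueness

/-! ### Finite slope parts of commuting endomorphisms -/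

section FiniteSlope

variable {K V : Type*} [Field K] [AddCommGroup V] [Module K V]

/-- The sum of the generalized eigenspaces for the nonzero eigenvalues. -/
def finiteSlope (D : Module.End K V) : Submodule K V :=
  ⨆ (t : K) (_ : t ≠ 0), D.maxGenEigenspace t

/-- The kernel lies in the generalized eigenspace for $0$, which is independent of the others. -/
theorem eq_zero_of_mem_finiteSlope {D : Module.End K V} {z : V} (hz : z ∈ finiteSlope D)
    (hD : D z = 0) : z = 0 := by
  have h0 : z ∈ D.maxGenEigenspace 0 := by
    rw [Module.End.mem_maxGenEigenspace]
    exact ⟨1, by simpa using hD⟩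
  exact (Submodule.disjoint_def.1 (Module.End.independent_maxGenEigenspace D 0)) z h0 hz

theorem apply_mem_finiteSlope {D g : Module.End K V} (h : Commute D g) {z : V}
    (hz : z ∈ finiteSlope D) : g z ∈ finiteSlope D := by
  have : finiteSlope D ≤ (finiteSlope D).comap g :=
    iSup₂_le fun t ht y hy => Submodule.mem_iSup_of_mem t (Submodule.mem_iSup_of_mem ht
      (Module.End.mapsTo_maxGenEigenspace_of_comm h t hy))
  exact this hz

/-- Peel off one factor at a time: the remaining product commutes with `D`, so it keeps `z` in the
finite slope part of `D`, where `D` is injective. -/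
theorem eq_zero_of_list_prod_apply_eq_zero {ls : List (Module.End K V)}
    (hls : ∀ D ∈ ls, ∀ D' ∈ ls, Commute D D') {z : V} (hz : ∀ D ∈ ls, z ∈ finiteSlope D)
    (h : ls.prod z = 0) : z = 0 := by
  induction ls with
  | nil => simpa using h
  | cons D ls ih =>
    rw [List.prod_cons, Module.End.mul_apply] at h
    simp only [List.mem_cons, forall_eq_or_imp] at hls hz
    refine ih (fun D₁ h₁ D₂ h₂ => (hls.2 D₁ h₁).2 D₂ h₂) hz.2 ?_
    exact eq_zero_of_mem_finiteSlope
      (apply_mem_finiteSlope (Commute.list_prod_right _ _ fun D' hD' => hls.1.2 D' hD') hz.1) h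

theorem maxGenEigenspace_le_comap {V' : Type*} [AddCommGroup V'] [Module K V']
    {D : Module.End K V} {D' : Module.End K V'} {φ : V →ₗ[K] V'} (h : ∀ z, φ (D z) = D' (φ z))
    (t : K) : D.maxGenEigenspace t ≤ (D'.maxGenEigenspace t).comap φ := by
  intro z hz
  rw [Module.End.mem_maxGenEigenspace] at hz
  obtain ⟨m, hm⟩ := hz
  rw [Submodule.mem_comap, Module.End.mem_maxGenEigenspace]
  refine ⟨m, ?_⟩
  have : ∀ y, φ (((D - t • 1) ^ m) y) = ((D' - t • 1) ^ m) (φ y) := by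
    clear hm
    induction m with
    | zero => simp
    | succ m ih =>
      intro y
      rw [pow_succ', pow_succ', Module.End.mul_apply, Module.End.mul_apply]
      simp [h, ih]
  rw [← this, hm, map_zero]

/-- `φ` intertwines `D` with the scalar `s` on the line `K`, whose only generalized eigenvalue is
`s`. -/
theorem eigenvalue_eq_of_mem_maxGenEigenspace {D : Module.End K V} {φ : V →ₗ[K] K} {s t : K}
    (h : ∀ z, φ (D z) = s * φ z) {z : V} (hz : z ∈ D.maxGenEigenspace t) (hφ : φ z ≠ 0) :
    s = t := by
  have h1 := maxGenEigenspace_le_comap (D' := s • 1) (φ := φ) (fun z => by simp [h]) t hz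
  rw [Submodule.mem_comap, Module.End.mem_maxGenEigenspace] at h1
  obtain ⟨m, hm⟩ := h1
  have h2 : (s • 1 - t • 1 : Module.End K K) = (s - t) • 1 := (sub_smul s t 1).symm
  rw [h2, smul_pow, one_pow, LinearMap.smul_apply, Module.End.one_apply, smul_eq_mul,
    mul_eq_zero] at hm
  exact sub_eq_zero.1 (eq_zero_of_pow_eq_zero (hm.resolve_right hφ))

end FiniteSlope

/-! ### Taylor expansions at the identity of `Nop` -/

section Taylor

variable {p : ℕ} [Fact p.Prime] {ι : Type w} [DecidableEq ι] {a : ι → ℕ}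
  {O : ι → Type v} [∀ i, CommRing (O i)] [∀ i, Algebra ℤ_[p] (O i)]
  {K : Type u} [NormedField K] [NormedAlgebra ℚ_[p] K] [Algebra ℤ_[p] K]

/-! ### Contraction of $N$ by the conjugations -/

/-- The coordinates that are multiplied by `p` under `conjBlock i j`. -/
def IsScaled (i : ι) (j : ℕ) (e : Coord p a O K) : Prop :=
  e.1 = i ∧ (e.2.2.1.2 : ℕ) < a e.1 - j ∧ a e.1 - j ≤ (e.2.2.1.1 : ℕ)

instance (i : ι) (j : ℕ) (e : Coord p a O K) : Decidable (IsScaled i j e) :=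
  inferInstanceAs (Decidable (_ ∧ _ ∧ _))

theorem coord_conjBlock_eq (i : ι) (j : ℕ) (l : Nop p a O) (e : Coord p a O K) :
    (conjBlock i j l).coord e = (if IsScaled i j e then (p : K) else 1) * l.coord e := by
  obtain ⟨i', τ, ⟨⟨r, c⟩, hrc⟩⟩ := e
  by_cases h : i' = i
  · subst h
    simp only [Nop.coord, conjBlock, Function.update_self, conjD_apply, IsScaled, true_and]
    split_ifs
    · rw [map_mul, map_natCast]
    · rw [one_mul]
  · simp only [Nop.coord, conjBlock, Function.update_of_ne h, IsScaled, h, false_and, if_false,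
      one_mul]

theorem conjD_comm {n : ℕ} {R : Type*} [CommRing R] (q j j' : ℕ) (l : nop n R q) :
    conjD q j (conjD q j' l) = conjD q j' (conjD q j l) := by
  apply Subtype.ext
  apply Units.ext
  ext r c
  simp only [conjD_apply]
  split_ifs <;> rfl

theorem conjBlock_comm (i i' : ι) (j j' : ℕ) (l : Nop p a O) :
    conjBlock i j (conjBlock i' j' l) = conjBlock i' j' (conjBlock i j l) := by
  by_cases h : i = i'
  · subst h
    simp [conjBlock, conjD_comm p j j']
  · simp only [conjBlock, Function.update_of_ne h, Function.update_of_ne (Ne.symm h)]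
    exact Function.update_comm (Ne.symm h) _ _ _

variable (p a O K) in
/-- Composition with `conjBlock i j`. -/
noncomputable def compConj (i : ι) (j : ℕ) : Module.End K (Nop p a O → K) :=
  LinearMap.funLeft K K (conjBlock i j)

theorem compConj_commute (i i' : ι) (j j' : ℕ) :
    Commute (compConj p a O K i j) (compConj p a O K i' j') := by
  refine LinearMap.ext fun h => funext fun l => ?_
  exact congrArg h (conjBlock_comm i' i j' j l)

/-- A product of operators `compConj` sends a function that vanishes on a polydisc to a function
that vanishes on a larger polydisc. -/
theorem list_prod_compConj_apply_eq_zero {h : Nop p a O → K} {ρ : Coord p a O K → ℝ}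
    (hh : ∀ y : Nop p a O, (∀ e : Coord p a O K, ‖y.coord e‖ ≤ ρ e) → h y = 0)
    (ls : List (ι × ℕ)) (y : Nop p a O)
    (hy : ∀ e : Coord p a O K,
      ‖(p : K)‖ ^ ls.countP (fun q => IsScaled q.1 q.2 e) * ‖y.coord e‖ ≤ ρ e) :
    (ls.map fun q => compConj p a O K q.1 q.2).prod h y = 0 := by
  induction ls generalizing y with
  | nil => exact hh y (by simpa using hy)
  | cons q ls ih =>
    rw [List.map_cons, List.prod_cons]
    -- The outermost operator moves the point: each coordinate scaled by `q` absorbs one factor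
    -- $|p|$ of the count.
    refine ih (conjBlock q.1 q.2 y) fun e => (le_of_eq ?_).trans (hy e)
    rw [coord_conjBlock_eq, norm_mul, List.countP_cons]
    by_cases hq : IsScaled q.1 q.2 e
    · simp [hq, pow_succ, mul_assoc]
    · simp [hq]

/-- `τ` is $\mathbb Z_p$-linear, so its values are bounded by those on finitely many generators.
Hence the coordinates are bounded on $N$, and finitely many contractions suffice. -/
theorem exists_norm_algHom_le [IsScalarTower ℤ_[p] ℚ_[p] K] {A : Type*} [CommRing A]
    [Algebra ℤ_[p] A] [Module.Finite ℤ_[p] A] (τ : A →ₐ[ℤ_[p]] K) : ∃ C : ℝ, ∀ y, ‖τ y‖ ≤ C := by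
  obtain ⟨n, φ, hφ⟩ := Module.Finite.exists_fin' ℤ_[p] A
  refine ⟨∑ j, ‖τ (φ fun i => if j = i then 1 else 0)‖, fun y => ?_⟩
  obtain ⟨z, rfl⟩ := hφ y
  rw [LinearMap.pi_apply_eq_sum_univ φ z, map_sum]
  refine (norm_sum_le _ _).trans (Finset.sum_le_sum fun j _ => ?_)
  have h : ∀ x : K, z j • x = (z j : ℚ_[p]) • x := fun x =>
    (algebraMap_smul ℚ_[p] (z j) x).symm
  rw [map_smul, h, norm_smul]
  exact mul_le_of_le_one_left (norm_nonneg _) (z j).2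

theorem norm_natCast_p : ‖(p : K)‖ = (p : ℝ)⁻¹ := by
  rw [← map_natCast (algebraMap ℚ_[p] K) p, norm_algebraMap', Padic.norm_p]

variable [Fintype ι] [∀ i, Fintype (O i →ₐ[ℤ_[p]] K)]

/-- A function on `Nop` of finite slope that vanishes on a polydisc centred at the identity is
zero. -/
theorem eq_zero_of_finiteSlope [IsScalarTower ℤ_[p] ℚ_[p] K] [∀ i, Module.Finite ℤ_[p] (O i)]
    {h : Nop p a O → K} {ρ : Coord p a O K → ℝ} (hρ : ∀ e, 0 < ρ e)
    (hh : ∀ y : Nop p a O, (∀ e : Coord p a O K, ‖y.coord e‖ ≤ ρ e) → h y = 0)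
    (hs : ∀ i j, 1 ≤ j → j < a i → h ∈ finiteSlope (compConj p a O K i j)) : h = 0 := by
  classical
  have hp1 : ‖(p : K)‖ < 1 := by
    rw [norm_natCast_p]
    exact inv_lt_one_of_one_lt₀ (by exact_mod_cast (Fact.out : p.Prime).one_lt)
  choose C hC using fun e : Coord p a O K => exists_norm_algHom_le e.2.1
  obtain ⟨M, hM⟩ : ∃ M : ℕ, ∀ e, ‖(p : K)‖ ^ M * C e ≤ ρ e := by
    have h1 : ∀ᶠ M : ℕ in atTop, ∀ e, ‖(p : K)‖ ^ M * C e ≤ ρ e := by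
      rw [eventually_all]
      intro e
      have h2 := (tendsto_pow_atTop_nhds_zero_of_lt_one (norm_nonneg _) hp1).mul_const (C e)
      rw [zero_mul] at h2
      exact h2.eventually_le_const (hρ e)
    exact h1.exists
  -- The coordinate in row $r$ is scaled by $\delta_{i,a_i-r}$, since its column is less than $r$.
  -- Below the diagonal $0 < r < a_i$, so this index is admissible.
  let pair : Coord p a O K → ι × ℕ := fun e => (e.1, a e.1 - e.2.2.1.1)
  let ls : List (ι × ℕ) := (List.replicate M (Finset.univ.toList.map pair)).flatten
  have hls : ∀ q ∈ ls, ∃ e : Coord p a O K, pair e = q := by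
    intro q hq
    obtain ⟨l', hl', hq'⟩ := List.mem_flatten.1 hq
    rw [List.eq_of_mem_replicate hl'] at hq'
    obtain ⟨e, -, he⟩ := List.mem_map.1 hq'
    exact ⟨e, he⟩
  refine eq_zero_of_list_prod_apply_eq_zero
    (ls := ls.map fun q => compConj p a O K q.1 q.2) ?_ ?_ ?_
  · intro D hD D' hD'
    obtain ⟨q, -, rfl⟩ := List.mem_map.1 hD
    obtain ⟨q', -, rfl⟩ := List.mem_map.1 hD'
    exact compConj_commute _ _ _ _
  · intro D hD
    obtain ⟨q, hq, rfl⟩ := List.mem_map.1 hD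
    obtain ⟨e, rfl⟩ := hls q hq
    have h1 := e.2.2.2
    rw [Fin.lt_def] at h1
    have h2 := e.2.2.1.1.isLt
    exact hs _ _ (by simp only [pair]; omega) (by simp only [pair]; omega)
  · funext y
    refine list_prod_compConj_apply_eq_zero hh ls y fun e => ?_
    -- Each of the `M` copies of the list scales `e` at least once.
    have hcount : M ≤ ls.countP (fun q => IsScaled q.1 q.2 e) := by
      have h1 : 1 ≤ (Finset.univ.toList.map pair).countP (fun q => IsScaled q.1 q.2 e) := by
        rw [Nat.one_le_iff_ne_zero, ← Nat.pos_iff_ne_zero, List.countP_pos_iff]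
        refine ⟨pair e, List.mem_map_of_mem (by simp), ?_⟩
        have h2 := e.2.2.2
        rw [Fin.lt_def] at h2
        have h3 := e.2.2.1.1.isLt
        simp only [pair, IsScaled, true_and, decide_eq_true_eq]
        omega
      rw [List.countP_flatten, List.map_replicate, List.sum_replicate, smul_eq_mul]
      exact Nat.le_mul_of_pos_right M h1
    refine le_trans ?_ (hM e)
    exact mul_le_mul (pow_le_pow_of_le_one (norm_nonneg _) hp1.le hcount) (hC e _)
      (norm_nonneg _) (by positivity)

/-- The degree of a monomial in the coordinates that are multiplied by `p` under
`conjBlock i j`. -/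
def scaledDeg (i : ι) (j : ℕ) (α : Coord p a O K →₀ ℕ) : ℕ := ∑ e with IsScaled i j e, α e

/-- The operator $\delta_{i,a_i-(c+1)}$ scales columns $\le c$ in rows $\ge c+1$, for every
embedding at once; this includes all of column $c$ below the diagonal. -/
theorem colDeg_le_scaledDeg (α : Coord p a O K →₀ ℕ) (i : ι) (τ : O i →ₐ[ℤ_[p]] K)
    {c : Fin (a i)} (hc : (c : ℕ) + 1 < a i) :
    colDeg (fun x => α ⟨i, τ, x⟩) c ≤ scaledDeg i (a i - (c + 1)) α := by
  classical
  let φ : {x : Fin (a i) × Fin (a i) // x.2 < x.1} → Coord p a O K := fun x => ⟨i, τ, x⟩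
  have hφ : Function.Injective φ := fun x y h => by simpa [φ] using h
  rw [colDeg, scaledDeg, ← Finset.sum_image (f := fun e => α e) (g := φ) hφ.injOn]
  refine Finset.sum_le_sum_of_subset fun e he => ?_
  obtain ⟨x, hx, rfl⟩ := Finset.mem_image.1 he
  have h1 : x.1.2 = c := (Finset.mem_filter.1 hx).2
  have h2 := x.2
  rw [h1, Fin.lt_def] at h2
  refine Finset.mem_filter.2 ⟨Finset.mem_univ _, rfl, ?_, ?_⟩
  · change (x.1.2 : ℕ) < a i - (a i - (c + 1))
    rw [h1]
    omega
  · change a i - (a i - (c + 1)) ≤ (x.1.1 : ℕ)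
    omega

theorem prod_coord_conjBlock (i : ι) (j : ℕ) (α : Coord p a O K →₀ ℕ) (l : Nop p a O) :
    (α.prod fun e m => (conjBlock i j l).coord e ^ m) =
      (p : K) ^ scaledDeg i j α * α.prod fun e m => l.coord e ^ m := by
  rw [Finsupp.prod_fintype _ _ (by simp), Finsupp.prod_fintype _ _ (by simp)]
  simp only [coord_conjBlock_eq, mul_pow, Finset.prod_mul_distrib]
  congr 1
  rw [scaledDeg, ← Finset.prod_pow_eq_pow_sum, Finset.prod_filter]
  refine Finset.prod_congr rfl fun e _ => ?_
  split_ifs <;> simp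

/-! ### Taylor coefficients and slopes -/

variable {k : Weight p a O K} {w : ι → ℝ}

theorem exists_taylor (f : analyticInduction k w) : ∃ c : (Coord p a O K →₀ ℕ) → K,
    ∀ y : Nop p a O, (∀ e : Coord p a O K, ‖y.coord e‖ ≤ (p : ℝ) ^ (-(w e.1))) →
      HasSum (fun α : Coord p a O K →₀ ℕ => c α * α.prod fun e m => y.coord e ^ m)
        ((f : Iw p a O → K) (y.toIw p)) := by
  obtain ⟨c, -, hc⟩ := f.2.2 1
  have h1 : ∀ e : Coord p a O K, (1 : Nop p a O).coord e = 0 := by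
    intro e
    change e.2.1 ((1 : Matrix (Fin (a e.1)) (Fin (a e.1)) (O e.1)) e.2.2.1.1 e.2.2.1.2) = 0
    rw [Matrix.one_apply_ne (ne_of_gt e.2.2.2), map_zero]
  simp only [h1, sub_zero] at hc
  exact ⟨c, hc⟩

variable [IsScalarTower ℤ_[p] ℚ_[p] K] [CompleteSpace K]

theorem taylor_unique {c c' : (Coord p a O K →₀ ℕ) → K} {f : Nop p a O → K}
    (hc : ∀ y : Nop p a O, (∀ e : Coord p a O K, ‖y.coord e‖ ≤ (p : ℝ) ^ (-(w e.1))) →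
      HasSum (fun α : Coord p a O K →₀ ℕ => c α * α.prod fun e m => y.coord e ^ m) (f y))
    (hc' : ∀ y : Nop p a O, (∀ e : Coord p a O K, ‖y.coord e‖ ≤ (p : ℝ) ^ (-(w e.1))) →
      HasSum (fun α : Coord p a O K →₀ ℕ => c' α * α.prod fun e m => y.coord e ^ m) (f y)) :
    c = c' := by
  have hp0 : (0 : ℝ) < p := by exact_mod_cast (Fact.out : p.Prime).pos
  funext α
  refine sub_eq_zero.1 (coeff_eq_zero_of_hasSum (c := c - c')
    (ρ := fun e => (p : ℝ) ^ (-(w e.1))) (fun e => Real.rpow_pos_of_pos hp0 _) (fun y hy => ?_) α)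
  simpa only [Pi.sub_apply, sub_mul, sub_self] using (hc y hy).sub (hc' y hy)

/-- The coefficients of the power series expansion at the identity. -/
noncomputable def taylor (k : Weight p a O K) (w : ι → ℝ) :
    analyticInduction k w →ₗ[K] ((Coord p a O K →₀ ℕ) → K) where
  toFun f := (exists_taylor f).choose
  map_add' f f' := by
    refine taylor_unique (w := w) (exists_taylor (f + f')).choose_spec fun y hy => ?_
    have h := ((exists_taylor f).choose_spec y hy).add ((exists_taylor f').choose_spec y hy)
    simp only [← add_mul] at h
    exact h
  map_smul' t f := by
    refine taylor_unique (w := w) (exists_taylor (t • f)).choose_spec fun y hy => ?_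
    have h := ((exists_taylor f).choose_spec y hy).mul_left t
    simp only [← mul_assoc] at h
    exact h

theorem hasSum_taylor (f : analyticInduction k w) (y : Nop p a O)
    (hy : ∀ e : Coord p a O K, ‖y.coord e‖ ≤ (p : ℝ) ^ (-(w e.1))) :
    HasSum (fun α : Coord p a O K →₀ ℕ => taylor k w f α * α.prod fun e m => y.coord e ^ m)
        ((f : Iw p a O → K) (y.toIw p)) :=
  (exists_taylor f).choose_spec y hy

variable [∀ i, IsLocalRing (O i)] (hp : ∀ i, Irreducible (p : O i))

/-- The conjugation maps the polydisc around the identity into itself, so substituting it in the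
series of `f` gives a valid expansion of `delta` applied to `f`; uniqueness identifies the
coefficients. -/
theorem taylor_delta (i : ι) (j : ℕ) (f : analyticInduction k w) (α : Coord p a O K →₀ ℕ) :
    taylor k w (delta hp k w i j f) α = (p : K) ^ scaledDeg i j α * taylor k w f α := by
  have hp1 : ‖(p : K)‖ ≤ 1 := by
    rw [norm_natCast_p]
    exact inv_le_one_of_one_le₀ (by exact_mod_cast (Fact.out : p.Prime).one_lt.le)
  have h := taylor_unique (w := w) (c := taylor k w (delta hp k w i j f))
    (c' := fun α => (p : K) ^ scaledDeg i j α * taylor k w f α)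
    (hasSum_taylor (delta hp k w i j f)) fun y hy => by
      have h1 := hasSum_taylor f (conjBlock i j y) fun e => by
        rw [coord_conjBlock_eq, norm_mul]
        refine (mul_le_of_le_one_left (norm_nonneg _) ?_).trans (hy e)
        split_ifs
        · exact hp1
        · exact norm_one.le
      have h2 : ((delta hp k w i j f : analyticInduction k w) : Iw p a O → K) (y.toIw p) =
          (f : Iw p a O → K) ((conjBlock i j y).toIw p) := deltaFun_apply_nop hp i j _ y
      rw [h2]
      convert h1 using 2 with α
      rw [prod_coord_conjBlock]
      ring
  exact congrFun h α

/-- The functional $f \mapsto c_\alpha$ can be nonzero only on the generalized eigenspace for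
$p^{d}$ with $d$ the scaled degree, so that eigenvalue must satisfy the slope bound. -/
theorem scaledDeg_lt_of_taylor_ne_zero {ν : ι → ℕ → ℝ} {f : analyticInduction k w}
    (hf : f ∈ smallSlope hp k w ν) {α : Coord p a O K →₀ ℕ} (hα : taylor k w f α ≠ 0)
    {i : ι} {j : ℕ} (h1 : 1 ≤ j) (h2 : j < a i) : (scaledDeg i j α : ℝ) < ν i j := by
  by_contra! hlt
  have hf' := (Submodule.mem_iInf _).1 ((Submodule.mem_iInf _).1
    ((Submodule.mem_iInf _).1 hf i) j) ⟨h1, h2⟩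
  let φ : analyticInduction k w →ₗ[K] K := (LinearMap.proj α).comp (taylor k w)
  refine hα ((iSup₂_le (fun t ht z hz => ?_) : _ ≤ LinearMap.ker φ) hf')
  rw [LinearMap.mem_ker]
  by_contra hz0
  have hst := eigenvalue_eq_of_mem_maxGenEigenspace (φ := φ)
    (fun z => taylor_delta hp i j z α) hz hz0
  have hp1 : (1 : ℝ) < p := by exact_mod_cast (Fact.out : p.Prime).one_lt
  rw [← hst, norm_pow, norm_natCast_p, ← Real.rpow_neg_one, ← Real.rpow_natCast,
    ← Real.rpow_mul (by positivity), Real.rpow_lt_rpow_left_iff hp1] at ht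
  linarith

/-- Each single exponent is bounded by the scaled degree for an operator that scales its coordinate,
so the support lies in a finite box. -/
theorem finite_support_taylor {ν : ι → ℕ → ℝ} {f : analyticInduction k w}
    (hf : f ∈ smallSlope hp k w ν) : (Function.support (taylor k w f)).Finite := by
  classical
  refine (Set.finite_Icc 0 (Finsupp.equivFunOnFinite.symm fun e : Coord p a O K =>
    ⌈ν e.1 (a e.1 - e.2.2.1.1)⌉₊)).subset fun α hα =>
    ⟨zero_le, fun e => ?_⟩
  have h1 := e.2.2.2
  rw [Fin.lt_def] at h1
  have h2 := e.2.2.1.1.isLt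
  have h3 := scaledDeg_lt_of_taylor_ne_zero hp hf hα (i := e.1) (j := a e.1 - e.2.2.1.1)
    (by omega) (by omega)
  have h4 : α e ≤ scaledDeg e.1 (a e.1 - e.2.2.1.1) α := by
    refine Finset.single_le_sum (f := fun e => α e) (fun _ _ => Nat.zero_le _) ?_
    exact Finset.mem_filter.2 ⟨Finset.mem_univ _, rfl, by omega, by omega⟩
  have h5 : (α e : ℝ) ≤ ⌈ν e.1 (a e.1 - e.2.2.1.1)⌉₊ :=
    (Nat.cast_le.2 h4).trans (h3.le.trans (Nat.le_ceil _))
  exact_mod_cast h5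

/-- A monomial is an eigenvector whose eigenvalue is a power of $p$, hence nonzero. -/
theorem monomial_mem_finiteSlope (i : ι) (j : ℕ) (α : Coord p a O K →₀ ℕ) :
    (fun l : Nop p a O => α.prod fun e m => l.coord e ^ m) ∈
      finiteSlope (compConj p a O K i j) := by
  have hp0 : (p : K) ≠ 0 := by
    rw [← norm_ne_zero_iff, norm_natCast_p, ne_eq, inv_eq_zero]
    exact_mod_cast (Fact.out : p.Prime).ne_zero
  refine Submodule.mem_iSup_of_mem ((p : K) ^ scaledDeg i j α)
    (Submodule.mem_iSup_of_mem (pow_ne_zero _ hp0) ?_)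
  rw [Module.End.mem_maxGenEigenspace]
  refine ⟨1, ?_⟩
  rw [pow_one, LinearMap.sub_apply, sub_eq_zero]
  exact funext fun l => prod_coord_conjBlock i j α l

/-- A function of small slope is given on `Nop` by a polynomial. -/
theorem eq_sum_taylor [∀ i, Module.Finite ℤ_[p] (O i)] {ν : ι → ℕ → ℝ}
    {f : analyticInduction k w} (hf : f ∈ smallSlope hp k w ν) (l : Nop p a O) :
    (f : Iw p a O → K) (l.toIw p) = ∑ α ∈ (finite_support_taylor hp hf).toFinset,
      taylor k w f α * α.prod fun e m => l.coord e ^ m := by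
  have hp0 : (0 : ℝ) < p := by exact_mod_cast (Fact.out : p.Prime).pos
  let P : Nop p a O → K := ∑ α ∈ (finite_support_taylor hp hf).toFinset,
    taylor k w f α • fun l => α.prod fun e m => l.coord e ^ m
  have hP : ∀ l, P l = ∑ α ∈ (finite_support_taylor hp hf).toFinset,
      taylor k w f α * α.prod fun e m => l.coord e ^ m := fun l => by
    simp [P, Finset.sum_apply]
  let res : analyticInduction k w →ₗ[K] (Nop p a O → K) :=
    (LinearMap.funLeft K K (Nop.toIw p)).comp (Submodule.subtype _)
  -- The difference vanishes on the polydisc of the Taylor expansion, and both terms have finite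
  -- slope for every operator.
  have h0 : res f - P = 0 := by
    refine eq_zero_of_finiteSlope (ρ := fun e => (p : ℝ) ^ (-(w e.1)))
      (fun e => Real.rpow_pos_of_pos hp0 _) (fun y hy => ?_) fun i j h1 h2 => ?_
    · rw [Pi.sub_apply, hP, sub_eq_zero]
      refine (hasSum_taylor f y hy).unique (hasSum_sum_of_ne_finset_zero fun α hα => ?_)
      rw [Set.Finite.mem_toFinset, Function.notMem_support] at hα
      rw [hα, zero_mul]
    · refine sub_mem ?_ (sum_mem fun α _ =>
        Submodule.smul_mem _ _ (monomial_mem_finiteSlope i j α))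
      have hf' := (Submodule.mem_iInf _).1 ((Submodule.mem_iInf _).1
        ((Submodule.mem_iInf _).1 hf i) j) ⟨h1, h2⟩
      refine (iSup₂_le (fun t ht z hz => ?_) :
        _ ≤ (finiteSlope (compConj p a O K i j)).comap res) hf'
      -- The condition $p^{-\nu} < |t|$ excludes the eigenvalue $0$, so small slope implies finite
      -- slope.
      have ht0 : t ≠ 0 := by
        rintro rfl
        rw [norm_zero] at ht
        exact absurd ht (Real.rpow_pos_of_pos hp0 _).le.not_gt
      refine Submodule.mem_iSup_of_mem t (Submodule.mem_iSup_of_mem ht0 ?_)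
      exact maxGenEigenspace_le_comap (D' := compConj p a O K i j) (φ := res)
        (fun z => funext fun l => deltaFun_apply_nop hp i j (z : Iw p a O → K) l) t hz
  rw [← hP, ← sub_eq_zero]
  exact congrFun h0 l

end Taylor

end Iwahoric

/-! ### Small slope implies algebraic -/

theorem mainTheorem8
    (p : ℕ) [Fact p.Prime] (_hp2 : p ≠ 2)
    {ι : Type w} [Fintype ι] [DecidableEq ι] (a : ι → ℕ)
    (O : ι → Type v) [∀ i, CommRing (O i)] [∀ i, IsDomain (O i)]
    [∀ i, IsDiscreteValuationRing (O i)] [∀ i, Algebra ℤ_[p] (O i)]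
    [∀ i, Module.Finite ℤ_[p] (O i)]
    (hO : ∀ i, Irreducible (p : O i))
    (K : Type u) [NormedField K] [NormedAlgebra ℚ_[p] K] [FiniteDimensional ℚ_[p] K]
    [Algebra ℤ_[p] K] [IsScalarTower ℤ_[p] ℚ_[p] K]
    [∀ i, Fintype (O i →ₐ[ℤ_[p]] K)]
    (_hK : ∀ i, Fintype.card (O i →ₐ[ℤ_[p]] K) = Module.finrank ℤ_[p] (O i))
    (w : ι → ℝ) (_hw : ∀ i, 0 < w i)
    (k : Iwahoric.Weight p a O K) (_hk : k.IsDominant)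
    (ν : ι → ℕ → ℝ)
    (_hν : ∀ (i : ι) (j : ℕ) (h1 : 1 ≤ j) (h2 : j < a i),
      ν i (a i - j) = ⨅ τ : O i →ₐ[ℤ_[p]] K,
        ((k i τ ⟨j - 1, by omega⟩ - k i τ ⟨j, h2⟩ + 1 : ℤ) : ℝ))
    (f : Iwahoric.analyticInduction k w) (_hf : f ∈ Iwahoric.smallSlope hO k w ν) :
    ∃ F ∈ Iwahoric.algebraicInduction k,
      ∀ g : Iwahoric.Iw p a O, (f : Iwahoric.Iw p a O → K) g = F.app K (g.toGLRes p K) := by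
  have : CompleteSpace K := FiniteDimensional.complete ℚ_[p] K
  have hmem : Iwahoric.polyFun k (Iwahoric.finite_support_taylor hO _hf).toFinset
      (Iwahoric.taylor k w f) ∈ Iwahoric.algebraicInduction k := by
    refine Iwahoric.polyFun_mem_algebraicInduction _ fun α hα i τ j => ?_
    rw [Set.Finite.mem_toFinset] at hα
    by_cases hj : (j : ℕ) + 1 < a i
    · have h1 := Iwahoric.scaledDeg_lt_of_taylor_ne_zero hO _hf hα (i := i) (j := a i - (j + 1))
        (by omega) (by omega)
      -- Columns are counted from zero here and from one in the definition of $\nu$, whence the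
      -- shift to `j + 1`.
      rw [_hν i (j + 1) (by omega) hj] at h1
      have h2 := h1.trans_le (ciInf_le (Set.finite_range _).bddBelow τ)
      -- The infimum is at most its term at `τ`; between integers, being less than `gap + 1` means
      -- being at most `gap`.
      have h3 : (Iwahoric.scaledDeg i (a i - (j + 1)) α : ℤ) <
          k i τ j - k i τ ⟨j + 1, hj⟩ + 1 := by exact_mod_cast h2
      have h4 := Iwahoric.colDeg_le_scaledDeg α i τ hj
      rw [Iwahoric.gap, dif_pos hj]
      omega
    -- The last column has no entry below the diagonal, so both sides are zero.
    · rw [Iwahoric.colDeg_eq_zero _ hj, Iwahoric.gap, dif_neg hj]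
      rfl
  exact ⟨_, hmem, Iwahoric.eq_polyFun hO hmem f.2.1 (Iwahoric.eq_sum_taylor hO _hf)⟩
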